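/- Let $\mathcal X$ be a sample space with a metric $c$ (jointly measurable), $Q$ a probability measure on $\mathcal X$, $s\ge 1$, $M\ge 1$. For $m=1,\dots,M$ let $\hat P^{(m)}=\frac1{n_m}\sum_{j=1}^{n_m}\delta_{\omega^{(m)}_j}$ be the empirical measure of $n_m\ge1$ points $\omega_j^{(m)}\in\mathcal X$, let $r_m\ge 0$, and let $$\mathcal P_m=\Big\{P:\ \int c(x,x_0)^s\,dP(x)<\infty\ \ \forall x_0,\quad W_s(P,\hat P^{(m)})\le r_m\Big\},\qquad \mathcal P=\bigcup_{m=1}^M\mathcal P_m ,$$ where $P$ ranges over probability measures and $W_s$ is the Wasserstein distance of order $s$ for $c$. Assume $Q\notin\mathcal P$. For $\lambda\ge 0$, $u\in\mathbb R^{n_m}$ put $$C^{(m)}_{\lambda,u}(x)=\min_{1\le j\le n_m}\{\lambda c(x,\omega_j^{(m)})^s-u_j\},\qquad \eta^{(m)}(\lambda,u)=\int e^{-C^{(m)}_{\lambda,u}}\,dQ .$$ For each $m$ let $(\lambda_m^*,u_m^*)$ be a maximizer of $-\lambda r_m^s+\frac1{n_m}\sum_j u_j-\log\eta^{(m)}(\lambda,u)$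 over $\lambda\ge0$, $u\in\mathbb R^{n_m}$ (assumed to exist), let $$Z_m(x)=-C^{(m)}_{\lambda_m^*,u_m^*}(x)-\log\eta^{(m)}(\lambda_m^*,u_m^*),$$ and let $P^*_{(m)}$ be the measure with $dP^*_{(m)}/dQ=e^{Z_m}$. Observations $X_1,X_2,\dots$ are independent, with law $Q$ before time $\nu$ and law $P$ from time $\nu$ on (law $\mathbb P^P_\nu$ of the sequence; $\mathbb P_\infty$ if all have law $Q$), and $\mathcal F_k=\sigma(X_1,\dots,X_k)$. For a stopping time $\tau$ with values in $\mathbb N\cup\{\infty\}$ let $$\mathsf{WADD}^P(\tau)=\sup_{\nu\ge1}\operatorname{ess\,sup}\,\mathbb E^P_\nu[(\tau-\nu+1)^+\mid\mathcal F_{\nu-1}],\qquad C(\gamma)=\{\tau:\mathbb E_\infty[\tau]\ge\gamma\}.$$ Let $S^{(m)}_0=0$, $S_k^{(m)}=(S_{k-1}^{(m)})^++Z_m(X_k)$ and $\tau_{\mathrm{DR}}(b)=\inf\{k\ge1:\max_m S_k^{(m)}\ge b\}$. Then each $P^*_{(m)}$ belongs to $\mathcal P_m$ and minimizes $\mathsf{KL}(\cdot\,\|\,Q)$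 over $\mathcal P_m$ (it is a least favorable distribution); and with $I^*=\min_m\mathsf{KL}(P^*_{(m)}\|Q)$ and $b_\gamma=\log(M\gamma)$ we have $\tau_{\mathrm{DR}}(b_\gamma)\in C(\gamma)$ for every $\gamma>0$, and, as $\gamma\to\infty$, $$\sup_{P\in\mathcal P}\mathsf{WADD}^P(\tau_{\mathrm{DR}}(b_\gamma))=\inf_{\tau\in C(\gamma)}\sup_{P\in\mathcal P}\mathsf{WADD}^P(\tau)\cdot(1+o(1))=\frac{\log\gamma}{I^*}\,(1+o(1)).$$ -/

import Mathlib

open MeasureTheory ProbabilityTheory InformationTheory Filter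
open scoped ENNReal Topology

noncomputable section

namespace DRCuSum

variable {X : Type*} [MeasurableSpace X]

/-! ### Observation sequences, tests and performance measures

An observation sequence is a point `x : ℕ → X`; the coordinate `x k` is the observation `X_{k+1}`,
so that `X_1, …, X_k` are the coordinates `x 0, …, x (k - 1)`. -/

/-- `𝓕_k = σ(X_1, …, X_k)`; in particular `𝓕_0` is trivial. -/
def obsFiltration (X : Type*) [MeasurableSpace X] :
    Filtration ℕ (inferInstance : MeasurableSpace (ℕ → X)) where
  seq k := MeasurableSpace.comap (fun (x : ℕ → X) (i : Fin k) => x i) inferInstance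
  mono' k l hkl := by
    rintro _ ⟨t, ht, rfl⟩
    refine ⟨(fun (y : Fin l → X) (i : Fin k) => y (Fin.castLE hkl i)) ⁻¹' t, ?_, rfl⟩
    exact (measurable_pi_lambda _ fun i => measurable_pi_apply _) ht
  le' k := by
    rintro _ ⟨t, ht, rfl⟩
    exact (measurable_pi_lambda _ fun i => measurable_pi_apply _) ht

/-- `ℙ_∞`: all observations are i.i.d. with law `Q`. -/
def noChangeLaw (Q : Measure X) : Measure (ℕ → X) :=
  Measure.infinitePi fun _ => Q

/-- `ℙ_ν^P`: independent observations, `X_j ∼ Q` for `j < ν` and `X_j ∼ P` for `j ≥ ν`. -/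
def changeLaw (Q P : Measure X) (ν : ℕ) : Measure (ℕ → X) :=
  Measure.infinitePi fun k => if k + 1 < ν then Q else P

/-- `C(γ)`: stopping times, possibly infinite, with `𝔼_∞[τ] ≥ γ`. -/
def tests (Q : Measure X) (γ : ℝ) : Set ((ℕ → X) → ℕ∞) :=
  {τ | IsStoppingTime (obsFiltration X) τ ∧
    ENNReal.ofReal γ ≤ ∫⁻ x, (τ x : ℝ≥0∞) ∂(noChangeLaw Q)}

/-- Lorden's delay `sup_{ν ≥ 1} ess sup 𝔼_ν^P[(τ - ν + 1)⁺ | 𝓕_{ν-1}]`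
(subtraction in `ℝ≥0∞` is truncated at `0`). -/
def WADD (Q P : Measure X) (τ : (ℕ → X) → ℕ∞) : ℝ≥0∞ :=
  ⨆ (ν : ℕ) (_ : 1 ≤ ν),
    essSup (condLExp (obsFiltration X (ν - 1)) (changeLaw Q P ν)
      (fun x => (τ x : ℝ≥0∞) + 1 - (ν : ℝ≥0∞))) (changeLaw Q P ν)

/-- Worst-case delay over a class `𝒰` of post-change laws. -/
def worstDelay (Q : Measure X) (𝒰 : Set (Measure X)) (τ : (ℕ → X) → ℕ∞) : ℝ≥0∞ :=
  ⨆ P ∈ 𝒰, WADD Q P τ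

/-- The minimax value `inf_{τ ∈ C(γ)} sup_{P ∈ 𝒰} WADD^P(τ)`. -/
def minimaxDelay (Q : Measure X) (𝒰 : Set (Measure X)) (γ : ℝ) : ℝ≥0∞ :=
  ⨅ τ ∈ tests Q γ, worstDelay Q 𝒰 τ

/-- `f(γ) = g(γ) (1 + o(1))` as `γ → ∞`. As `0 / 0 = ∞ / ∞ = 0` in `ℝ≥0∞`, this includes that both
sides are eventually finite and positive. -/
def FirstOrderEq (f g : ℝ → ℝ≥0∞) : Prop :=
  Tendsto (fun γ => f γ / g γ) atTop (𝓝 1)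

/-! ### Wasserstein balls around empirical measures -/

/-- The empirical measure of `ω_1, …, ω_n`. -/
def empirical {n : ℕ} (ω : Fin n → X) : Measure X :=
  (n : ℝ≥0∞)⁻¹ • ∑ i, Measure.dirac (ω i)

/-- The Wasserstein distance of order `s`; the transport cost is the `s`-th power of the metric. -/
def wasserstein [MetricSpace X] (s : ℝ) (P P' : Measure X) : ℝ≥0∞ :=
  (⨅ (Γ : Measure (X × X)) (_ : Γ.map Prod.fst = P ∧ Γ.map Prod.snd = P'),
    ∫⁻ z, edist z.1 z.2 ^ s ∂Γ) ^ (1 / s)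

/-- The probability measures with finite `s`-th moments at Wasserstein distance at most `r` from the
empirical measure of `ω`. -/
def wassersteinBall [MetricSpace X] {n : ℕ} (s r : ℝ) (ω : Fin n → X) : Set (Measure X) :=
  {P | IsProbabilityMeasure P ∧ (∀ x₀, ∫⁻ x, edist x x₀ ^ s ∂P < ∞) ∧
    wasserstein s P (empirical ω) ≤ ENNReal.ofReal r}

/-! ### Least favorable distributions -/

/-- `P'` minimizes `KL(· ‖ Q)` over the class `𝒰`. -/
def IsLFD (Q : Measure X) (𝒰 : Set (Measure X)) (P' : Measure X) : Prop :=
  P' ∈ 𝒰 ∧ ∀ P ∈ 𝒰, klDiv P' Q ≤ klDiv P Q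

/-- `C_{λ,u}(x) = min_j {λ c(x, ω_j)^s - u_j}`. -/
def tiltCost [MetricSpace X] {n : ℕ} (s : ℝ) (ω : Fin n → X) (lam : ℝ) (u : Fin n → ℝ) (x : X) :
    ℝ :=
  ⨅ j, (lam * dist x (ω j) ^ s - u j)

/-- `η(λ,u) = ∫ exp(-C_{λ,u}) dQ`. -/
def tiltMass [MetricSpace X] {n : ℕ} (Q : Measure X) (s : ℝ) (ω : Fin n → X) (lam : ℝ)
    (u : Fin n → ℝ) : ℝ :=
  ∫ x, Real.exp (-tiltCost s ω lam u x) ∂Q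

/-- The dual objective `-λ r^s + (1/n) ∑_j u_j - log η(λ,u)`. -/
def dualObjective [MetricSpace X] {n : ℕ} (Q : Measure X) (s r : ℝ) (ω : Fin n → X) (lam : ℝ)
    (u : Fin n → ℝ) : ℝ :=
  -lam * r ^ s + (1 / (n : ℝ)) * ∑ j, u j - Real.log (tiltMass Q s ω lam u)

/-- `(λ,u)` maximizes the dual objective over `λ ≥ 0` and `u ∈ ℝⁿ`. -/
def IsDualSolution [MetricSpace X] {n : ℕ} (Q : Measure X) (s r : ℝ) (ω : Fin n → X) (lam : ℝ)
    (u : Fin n → ℝ) : Prop :=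
  0 ≤ lam ∧ ∀ (lam' : ℝ) (u' : Fin n → ℝ), 0 ≤ lam' →
    dualObjective Q s r ω lam' u' ≤ dualObjective Q s r ω lam u

/-- The log-likelihood ratio `log (p*(x) / q(x)) = -C_{λ,u}(x) - log η(λ,u)`. -/
def logLR [MetricSpace X] {n : ℕ} (Q : Measure X) (s : ℝ) (ω : Fin n → X) (lam : ℝ)
    (u : Fin n → ℝ) (x : X) : ℝ :=
  -tiltCost s ω lam u x - Real.log (tiltMass Q s ω lam u)

/-- The exponential tilting `P*` of `Q`: if `Q` has density `q` with respect to some measure, then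
`P*` has density `p* = q exp(-C_{λ,u}) / η(λ,u)` with respect to it. -/
def tilted [MetricSpace X] {n : ℕ} (Q : Measure X) (s : ℝ) (ω : Fin n → X) (lam : ℝ)
    (u : Fin n → ℝ) : Measure X :=
  Q.withDensity fun x => ENNReal.ofReal (Real.exp (logLR Q s ω lam u x))

/-! ### The CuSum test -/

/-- `S_0 = 0` and `S_k = (S_{k-1})⁺ + Z(X_k)`. -/
def cusum (Z : X → ℝ) (x : ℕ → X) : ℕ → ℝ
  | 0 => 0
  | k + 1 => max (cusum Z x k) 0 + Z (x k)

/-- `inf {k ≥ 1 : max_m S_k^{(m)} ≥ b}`, equal to `∞` if there is no such `k`. -/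
def cusumTest {M : ℕ} (Z : Fin M → X → ℝ) (b : ℝ) (x : ℕ → X) : ℕ∞ :=
  ⨅ (k : ℕ) (_ : 1 ≤ k ∧ b ≤ ⨆ m, cusum (Z m) x k), (k : ℕ∞)

end DRCuSum

end

/-! Convex duality produces the least favorable laws, and the CuSum theory then uses only three
facts about $Z_m$: $\int e^{Z_m}dQ=1$; $Z_m$ is bounded above; and $\int Z_m\,dP\ge\int
Z_m\,dP^*_{(m)}=\mathsf{KL}(P^*_{(m)}\|Q)$ for every $P\in\mathcal P_m$.

Duality. Optimality of $(\lambda^*,u^*)$ in the directions $(1,v)$ says that every dual value of the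
transport problem from $P^*$ to the empirical measure is at most $r^s$. Semi-discrete Kantorovich
duality, obtained by entropic regularization, turns this into $W_s\le r$
(`IsDualSolution.tilted_mem_wassersteinBall`). Optimality along the ray towards $0$ gives
complementary slackness, and with weak duality this is the third fact
(`IsDualSolution.integral_logLR_le`). Minimality of the divergence follows by Donsker–Varadhan.

False alarms. The sum of the $M$ Shiryaev–Roberts statistics dominates $\max_m e^{S^{(m)}}$ and
grows under $Q$ by $M$ per step in mean, so reaching $M\gamma$ takes at least $\gamma$ steps on
average (`cusumTest_mem_tests`).

Upper bound. Under $P\in\mathcal P_m$ the test stops no later than a random walk with increments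
$Z_m$ first reaches $b$. The increments are at most some $K$ with mean at least $I^*$, so Wald's
argument bounds the delay by $(b+K)/I^*$ (`WADD_cusumTest_le`).

Lower bound. The worst case is at least the delay at the $P^*_{(m)}$ attaining $I^*$. By change of
measure, a test reacting within $(1-\delta)\log\gamma/a$ steps, $a$ slightly above $I^*$, would
raise too many false alarms (`le_WADD_add`). The two bounds agree to first order because $M$ and $K$
enter only through an additive constant. -/

namespace DRCuSum

/-! ### Conditional expectations and essential suprema -/

/-- Reduces Lorden's essential supremum to integrals over events of the past, where independence
applies directly. The next lemma is the converse used for the lower bound. -/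
theorem essSup_condLExp_le {Ω : Type*} {m m₀ : MeasurableSpace Ω} (hm : m ≤ m₀)
    {μ : Measure[m₀] Ω} [IsFiniteMeasure μ] {f : Ω → ℝ≥0∞} {c : ℝ≥0∞}
    (h : ∀ A, MeasurableSet[m] A → ∫⁻ x in A, f x ∂μ ≤ c * μ A) :
    essSup (condLExp m μ f) μ ≤ c := by
  refine essSup_le_of_ae_le c ?_
  refine ae_le_of_ae_le_trim (hm := hm) ?_
  refine ae_le_of_forall_setLIntegral_le_of_sigmaFinite (measurable_condLExp m μ f) ?_
  intro A hA _
  rw [setLIntegral_condLExp_trim hm μ f hA, setLIntegral_const, trim_measurableSet_eq hm hA]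
  exact h A hA

theorem setLIntegral_le_essSup_condLExp {Ω : Type*} {m m₀ : MeasurableSpace Ω} (hm : m ≤ m₀)
    {μ : Measure[m₀] Ω} [IsFiniteMeasure μ] {f : Ω → ℝ≥0∞} {A : Set Ω}
    (hA : MeasurableSet[m] A) :
    ∫⁻ x in A, f x ∂μ ≤ essSup (condLExp m μ f) μ * μ A := by
  rw [← setLIntegral_condLExp hm μ f hA, ← setLIntegral_const]
  exact lintegral_mono_ae (ae_restrict_of_ae (ENNReal.ae_le_essSup _))

/-! ### Independent observations -/

variable {X : Type*} [MeasurableSpace X]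

instance (Q : Measure X) [IsProbabilityMeasure Q] : IsProbabilityMeasure (noChangeLaw Q) := by
  unfold noChangeLaw; infer_instance

theorem isProbabilityMeasure_ite (Q P : Measure X) [IsProbabilityMeasure Q]
    [IsProbabilityMeasure P] (ν k : ℕ) : IsProbabilityMeasure (if k + 1 < ν then Q else P) := by
  split_ifs <;> infer_instance

instance (Q P : Measure X) [IsProbabilityMeasure Q] [IsProbabilityMeasure P] (ν : ℕ) :
    IsProbabilityMeasure (changeLaw Q P ν) := by
  have := isProbabilityMeasure_ite Q P ν
  unfold changeLaw; infer_instance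

theorem measurable_obsFiltration_eval {i N : ℕ} (h : i < N) :
    Measurable[obsFiltration X N] fun x : ℕ → X => x i := by
  have : (fun x : ℕ → X => x i) =
      (fun y : Fin N → X => y ⟨i, h⟩) ∘ fun (x : ℕ → X) (j : Fin N) => x j := rfl
  rw [this]
  exact (measurable_pi_apply _).comp (comap_measurable _)

theorem indep_obsFiltration_eval (μ : ℕ → Measure X) [∀ i, IsProbabilityMeasure (μ i)] (N : ℕ) :
    Indep (obsFiltration X N) (MeasurableSpace.comap (fun x : ℕ → X => x N) inferInstance)
      (Measure.infinitePi μ) := by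
  have h := iIndepFun_infinitePi (P := μ) (X := fun _ x => x) (fun _ => measurable_id)
  have h' := h.indepFun_finset (Finset.range N) {N} (by simp) (fun i => measurable_pi_apply i)
  have hφ : Measurable fun (y : Finset.range N → X) (i : Fin N) => y ⟨i, by simp⟩ :=
    measurable_pi_lambda _ fun i => measurable_pi_apply _
  have hψ : Measurable fun (y : ({N} : Finset ℕ) → X) => y ⟨N, by simp⟩ :=
    measurable_pi_apply _
  exact h'.comp hφ hψ

theorem lintegral_mul_eval (μ : ℕ → Measure X) [∀ i, IsProbabilityMeasure (μ i)] (N : ℕ)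
    {g : (ℕ → X) → ℝ≥0∞} (hg : Measurable[obsFiltration X N] g) {h : X → ℝ≥0∞}
    (hh : Measurable h) :
    ∫⁻ x, g x * h (x N) ∂(Measure.infinitePi μ) =
      (∫⁻ x, g x ∂(Measure.infinitePi μ)) * ∫⁻ y, h y ∂(μ N) := by
  have := lintegral_mul_eq_lintegral_mul_lintegral_of_independent_measurableSpace
    ((obsFiltration X).le N) (measurable_pi_apply N).comap_le (indep_obsFiltration_eval μ N) hg
    (hh.comp (comap_measurable (fun x : ℕ → X => x N)))
  simp only [Function.comp] at this
  rw [this, ← (measurePreserving_eval_infinitePi μ N).lintegral_comp hh]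

theorem setLIntegral_eval (μ : ℕ → Measure X) [∀ i, IsProbabilityMeasure (μ i)] (N : ℕ)
    {A : Set (ℕ → X)} (hA : MeasurableSet[obsFiltration X N] A) {h : X → ℝ≥0∞}
    (hh : Measurable h) :
    ∫⁻ x in A, h (x N) ∂(Measure.infinitePi μ) =
      Measure.infinitePi μ A * ∫⁻ y, h y ∂(μ N) := by
  have hA' := (obsFiltration X).le N A hA
  have hind : Measurable[obsFiltration X N] (A.indicator fun _ => (1 : ℝ≥0∞)) := by
    let _ := obsFiltration X N
    exact Measurable.indicator measurable_const hA
  have := lintegral_mul_eval μ N hind hh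
  rw [lintegral_indicator hA', setLIntegral_one] at this
  rw [← this, ← lintegral_indicator hA']
  refine lintegral_congr fun x => ?_
  by_cases hx : x ∈ A <;> simp [hx]

/-- It suffices to compare rectangles, and there the integral of the product density factors by
independence of the coordinates. -/
theorem pi_withDensity {n : ℕ} (Q : Measure X) [IsProbabilityMeasure Q]
    (d : Fin n → X → ℝ≥0∞) (hd : ∀ i, Measurable (d i))
    [∀ i, IsProbabilityMeasure (Q.withDensity (d i))] :
    Measure.pi (fun i => Q.withDensity (d i)) =
      (Measure.pi fun _ : Fin n => Q).withDensity fun y => ∏ i, d i (y i) := by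
  refine Measure.pi_eq fun t ht => ?_
  rw [withDensity_apply _ (MeasurableSet.univ_pi ht), ← lintegral_indicator
    (MeasurableSet.univ_pi ht)]
  have h := iIndepFun_infinitePi (P := fun _ : Fin n => Q)
    (X := fun i => (t i).indicator (d i)) (fun i => (hd i).indicator (ht i))
  rw [Measure.infinitePi_eq_pi] at h
  have h2 := lintegral_prod_eq_prod_lintegral_of_indepFun Finset.univ _ h
    (fun i => ((hd i).indicator (ht i)).comp (measurable_pi_apply i))
  have h3 : ∀ i, ∫⁻ y : Fin n → X, (t i).indicator (d i) (y i) ∂(Measure.pi fun _ => Q) =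
      Q.withDensity (d i) (t i) := by
    intro i
    rw [(measurePreserving_eval (fun _ : Fin n => Q) i).lintegral_comp ((hd i).indicator (ht i)),
      lintegral_indicator (ht i), withDensity_apply _ (ht i)]
  simp only [h3] at h2
  rw [← h2]
  refine lintegral_congr fun y => ?_
  by_cases hy : y ∈ Set.univ.pi t
  · rw [Set.indicator_of_mem hy]
    refine Finset.prod_congr rfl fun i _ => ?_
    rw [Set.indicator_of_mem (hy i trivial)]
  · rw [Set.indicator_of_notMem hy]
    simp only [Set.mem_pi, Set.mem_univ, true_implies, not_forall] at hy
    obtain ⟨i, hi⟩ := hy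
    exact (Finset.prod_eq_zero (Finset.mem_univ i) (Set.indicator_of_notMem hi _)).symm

theorem infinitePi_map_prefix (μ : ℕ → Measure X) [∀ i, IsProbabilityMeasure (μ i)] (n : ℕ) :
    (Measure.infinitePi μ).map (fun (x : ℕ → X) (i : Fin n) => x i) =
      Measure.pi fun i : Fin n => μ i := by
  rw [← Measure.infinitePi_eq_pi]
  exact Measure.map_infinitePi_infinitePi_of_inj (P := μ) Fin.val_injective

/-- Change of measure on `𝓕_{N+k}` when the change happens after `N` observations. -/
theorem changeLaw_apply (Q : Measure X) [IsProbabilityMeasure Q] {d : X → ℝ≥0∞}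
    (hd : Measurable d) [IsProbabilityMeasure (Q.withDensity d)] (N k : ℕ) {A : Set (ℕ → X)}
    (hA : MeasurableSet[obsFiltration X (N + k)] A) :
    changeLaw Q (Q.withDensity d) (N + 1) A =
      ∫⁻ x in A, ∏ i ∈ Finset.range k, d (x (N + i)) ∂(noChangeLaw Q) := by
  obtain ⟨t, ht, rfl⟩ := hA
  have := isProbabilityMeasure_ite Q (Q.withDensity d) (N + 1)
  have hres : Measurable fun (x : ℕ → X) (i : Fin (N + k)) => x i := by fun_prop
  -- Coordinates before the change get density `1`, so that every marginal has a density with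
  -- respect to `Q`. Coordinate `i` is observation `i + 1`, hence a change at `ν = N + 1` leaves
  -- exactly the coordinates `i < N` unchanged.
  have hd' : ∀ i : Fin (N + k), Measurable (if (i : ℕ) < N then 1 else d) := by
    intro i; split_ifs
    · exact measurable_one
    · exact hd
  have hQ : ∀ i : ℕ, (if i + 1 < N + 1 then Q else Q.withDensity d) =
      Q.withDensity (if i < N then 1 else d) := by
    intro i
    by_cases h : i < N <;> simp [h]
  have hprob : ∀ i : ℕ, IsProbabilityMeasure (Q.withDensity (if i < N then 1 else d)) := by
    intro i; rw [← hQ]; infer_instance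
  rw [changeLaw, noChangeLaw, ← Measure.map_apply hres ht, infinitePi_map_prefix]
  simp_rw [hQ]
  rw [pi_withDensity Q (fun i : Fin (N + k) => if (i : ℕ) < N then 1 else d) hd',
    withDensity_apply _ ht, ← infinitePi_map_prefix (fun _ => Q), setLIntegral_map ht _ hres]
  · refine lintegral_congr fun x => ?_
    rw [Fin.prod_univ_add]
    simp [Finset.prod_range]
  · exact Finset.measurable_prod _ fun i _ => (hd' i).comp (measurable_pi_apply i)

end DRCuSum

/-! ### Expected stopping times and the Shiryaev–Roberts statistic -/

namespace DRCuSum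

theorem toENNReal_eq_tsum (t : ℕ∞) :
    (t : ℝ≥0∞) = ∑' k : ℕ, if (k : ℕ∞) < t then 1 else 0 := by
  induction t using ENat.recTopCoe with
  | top => simp
  | coe n =>
    rw [tsum_eq_sum (s := Finset.range n)]
    · rw [Finset.sum_congr rfl (g := fun _ => (1 : ℝ≥0∞))]
      · simp
      · intro k hk
        simpa using hk
    · intro k hk
      simpa using hk

theorem cusumTest_le_iff {X : Type*} {M : ℕ} (Z : Fin M → X → ℝ) (b : ℝ) (x : ℕ → X) (N : ℕ) :
    cusumTest Z b x ≤ N ↔ ∃ k ∈ Finset.Icc 1 N, b ≤ ⨆ m, cusum (Z m) x k := by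
  constructor
  · intro h
    by_contra hcon
    push Not at hcon
    have : ((N + 1 : ℕ) : ℕ∞) ≤ cusumTest Z b x := by
      refine le_iInf₂ fun k hk => ?_
      by_contra hlt
      rw [not_le] at hlt
      have hk' : k < N + 1 := by exact_mod_cast hlt
      exact absurd hk.2 (not_le.2 (hcon k (Finset.mem_Icc.2 ⟨hk.1, by omega⟩)))
    have h2 := this.trans h
    have : N + 1 ≤ N := by exact_mod_cast h2
    omega
  · rintro ⟨k, hk, hb⟩
    rw [Finset.mem_Icc] at hk
    exact (iInf₂_le k ⟨hk.1, hb⟩).trans (by exact_mod_cast hk.2)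

theorem cusumTest_pos {X : Type*} {M : ℕ} (Z : Fin M → X → ℝ) (b : ℝ) (x : ℕ → X) :
    0 < cusumTest Z b x := by
  have : ((1 : ℕ) : ℕ∞) ≤ cusumTest Z b x := le_iInf₂ fun k hk => by exact_mod_cast hk.1
  exact lt_of_lt_of_le (by simp) this

/-- The Shiryaev–Roberts statistic. -/
noncomputable def shiryaevRoberts {X : Type*} (Z : X → ℝ) (x : ℕ → X) : ℕ → ℝ≥0∞
  | 0 => 0
  | k + 1 => (1 + shiryaevRoberts Z x k) * ENNReal.ofReal (Real.exp (Z (x k)))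

/-- The exponential of CuSum is the largest likelihood ratio over candidate change points, and the
Shiryaev–Roberts statistic is their sum. The index starts at `1`: at `0` the left side would be `1`
and the right side `0`. -/
theorem exp_cusum_le_shiryaevRoberts {X : Type*} (Z : X → ℝ) (x : ℕ → X) :
    ∀ k, ENNReal.ofReal (Real.exp (cusum Z x (k + 1))) ≤ shiryaevRoberts Z x (k + 1) := by
  have step : ∀ k, ENNReal.ofReal (Real.exp (max (cusum Z x k) 0)) ≤ 1 + shiryaevRoberts Z x k →
      ENNReal.ofReal (Real.exp (cusum Z x (k + 1))) ≤ shiryaevRoberts Z x (k + 1) := by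
    intro k h
    rw [cusum, Real.exp_add, ENNReal.ofReal_mul (Real.exp_pos _).le, shiryaevRoberts]
    gcongr
  intro k
  refine step k ?_
  induction k with
  | zero => simp [cusum, shiryaevRoberts]
  | succ k ih =>
    rcases max_cases (cusum Z x (k + 1)) 0 with ⟨h, -⟩ | ⟨h, -⟩
    · rw [h]; exact (step k ih).trans le_add_self
    · rw [h]; simp

variable {X : Type*} [MeasurableSpace X]

theorem isStoppingTime_obsFiltration_iff {τ : (ℕ → X) → ℕ∞} :
    IsStoppingTime (obsFiltration X) τ ↔
      ∀ k : ℕ, MeasurableSet[obsFiltration X k] {x | τ x ≤ (k : ℕ∞)} :=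
  Iff.rfl

theorem measurableSet_lt_stoppingTime {τ : (ℕ → X) → ℕ∞}
    (hτ : IsStoppingTime (obsFiltration X) τ) (k : ℕ) :
    MeasurableSet[obsFiltration X k] {x | (k : ℕ∞) < τ x} := by
  have h2 : {x | (k : ℕ∞) < τ x} = {x | τ x ≤ (k : ℕ∞)}ᶜ := by
    ext x; simp
  rw [h2]
  exact (isStoppingTime_obsFiltration_iff.1 hτ k).compl

theorem lintegral_stoppingTime (μ : Measure (ℕ → X)) {τ : (ℕ → X) → ℕ∞}
    (hτ : IsStoppingTime (obsFiltration X) τ) :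
    ∫⁻ x, (τ x : ℝ≥0∞) ∂μ = ∑' k : ℕ, μ {x | (k : ℕ∞) < τ x} := by
  have hm : ∀ k : ℕ, MeasurableSet {x | (k : ℕ∞) < τ x} := fun k =>
    (obsFiltration X).le k _ (measurableSet_lt_stoppingTime hτ k)
  simp_rw [toENNReal_eq_tsum (τ _)]
  have : ∀ (k : ℕ) (x : ℕ → X), (if (k : ℕ∞) < τ x then (1 : ℝ≥0∞) else 0) =
      {x | (k : ℕ∞) < τ x}.indicator (fun _ => 1) x := by
    intro k x; simp [Set.indicator_apply]
  simp_rw [this]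
  rw [lintegral_tsum fun k => (measurable_const.indicator (hm k)).aemeasurable]
  refine tsum_congr fun k => ?_
  rw [lintegral_indicator (hm k), setLIntegral_one]

/-- If the compensator of `R` grows by at most `c` per step and `R` is at least `B` when `τ`
stops, then `B ≤ c 𝔼[τ]`. -/
theorem le_mul_lintegral_stoppingTime (μ : Measure (ℕ → X)) [IsProbabilityMeasure μ]
    {τ : (ℕ → X) → ℕ∞} (hτ : IsStoppingTime (obsFiltration X) τ) (hτ0 : ∀ x, 0 < τ x)
    {R : ℕ → (ℕ → X) → ℝ≥0∞} {B c : ℝ≥0∞} (hB : B ≠ ∞) (hc : c ≠ 0)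
    (hR : ∀ N A, MeasurableSet[obsFiltration X N] A →
      ∫⁻ x in A, R (N + 1) x ∂μ ≤ ∫⁻ x in A, R N x ∂μ + c * μ A)
    (hR0 : ∀ x, R 0 x = 0) (hRB : ∀ x (k : ℕ), τ x = k → B ≤ R k x) :
    B ≤ c * ∫⁻ x, (τ x : ℝ≥0∞) ∂μ := by
  have hmF := fun k => measurableSet_lt_stoppingTime hτ k
  have hm : ∀ k : ℕ, MeasurableSet {x | (k : ℕ∞) < τ x} := fun k => (obsFiltration X).le k _ (hmF k)
  rw [lintegral_stoppingTime μ hτ]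
  -- Optional stopping by induction: paths already stopped contribute `B`, running paths contribute
  -- the current `R`, and the total grows by at most `c` times the probability of still running. The
  -- set `D` below collects the paths that stop exactly at `N + 1`.
  have key : ∀ N : ℕ, B * μ {x | (N : ℕ∞) < τ x}ᶜ + ∫⁻ x in {x | (N : ℕ∞) < τ x}, R N x ∂μ ≤
      c * ∑ k ∈ Finset.range N, μ {x | (k : ℕ∞) < τ x} := by
    intro N
    induction N with
    | zero => simp [hτ0, hR0]
    | succ N ih =>
      set D := {x | (N : ℕ∞) < τ x} ∩ {x | ((N + 1 : ℕ) : ℕ∞) < τ x}ᶜ with hD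
      have hsub : {x | ((N + 1 : ℕ) : ℕ∞) < τ x} ⊆ {x | (N : ℕ∞) < τ x} := fun x hx =>
        (show (N : ℕ∞) < ((N + 1 : ℕ) : ℕ∞) by exact_mod_cast N.lt_succ_self).trans hx
      have hDm : MeasurableSet D := (hm N).inter (hm (N + 1)).compl
      have hsplit : {x | ((N + 1 : ℕ) : ℕ∞) < τ x}ᶜ = {x | (N : ℕ∞) < τ x}ᶜ ∪ D := by
        ext x
        have := @hsub x
        simp only [hD, Set.mem_union, Set.mem_inter_iff, Set.mem_compl_iff] at *
        tauto
      have hsplit2 : {x | (N : ℕ∞) < τ x} = D ∪ {x | ((N + 1 : ℕ) : ℕ∞) < τ x} := by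
        ext x
        have := @hsub x
        simp only [hD, Set.mem_union, Set.mem_inter_iff, Set.mem_compl_iff] at *
        tauto
      have hdisj : Disjoint D {x | ((N + 1 : ℕ) : ℕ∞) < τ x} :=
        Set.disjoint_left.2 fun x hx hx' => hx.2 hx'
      have hBD : B * μ D ≤ ∫⁻ x in D, R (N + 1) x ∂μ := by
        rw [← setLIntegral_const]
        refine setLIntegral_mono' hDm fun x hx => hRB x (N + 1) ?_
        refine le_antisymm (not_lt.1 hx.2) ?_
        have h1 : (N : ℕ∞) < τ x := hx.1
        have := Order.add_one_le_of_lt h1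
        exact_mod_cast this
      calc B * μ {x | ((N + 1 : ℕ) : ℕ∞) < τ x}ᶜ +
            ∫⁻ x in {x | ((N + 1 : ℕ) : ℕ∞) < τ x}, R (N + 1) x ∂μ
          ≤ B * (μ {x | (N : ℕ∞) < τ x}ᶜ + μ D) +
            ∫⁻ x in {x | ((N + 1 : ℕ) : ℕ∞) < τ x}, R (N + 1) x ∂μ := by
            gcongr; rw [hsplit]; exact measure_union_le _ _
        _ ≤ B * μ {x | (N : ℕ∞) < τ x}ᶜ + (∫⁻ x in D, R (N + 1) x ∂μ +
            ∫⁻ x in {x | ((N + 1 : ℕ) : ℕ∞) < τ x}, R (N + 1) x ∂μ) := by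
            rw [mul_add, add_assoc]; gcongr
        _ = B * μ {x | (N : ℕ∞) < τ x}ᶜ + ∫⁻ x in {x | (N : ℕ∞) < τ x}, R (N + 1) x ∂μ := by
            rw [← lintegral_union (hm (N + 1)) hdisj, ← hsplit2]
        _ ≤ B * μ {x | (N : ℕ∞) < τ x}ᶜ + (∫⁻ x in {x | (N : ℕ∞) < τ x}, R N x ∂μ +
            c * μ {x | (N : ℕ∞) < τ x}) := by
            gcongr; exact hR N _ (hmF N)
        _ ≤ _ := by
            rw [← add_assoc, Finset.sum_range_succ, mul_add]
            gcongr
  by_cases htop : ∑' k : ℕ, μ {x | (k : ℕ∞) < τ x} = ∞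
  · rw [htop, ENNReal.mul_top hc]; exact le_top
  have hlim : Tendsto (fun N : ℕ => μ {x | (N : ℕ∞) < τ x}) atTop (𝓝 0) :=
    ENNReal.tendsto_atTop_zero_of_tsum_ne_top htop
  have hlim' : Tendsto (fun N : ℕ => B * (1 - μ {x | (N : ℕ∞) < τ x})) atTop (𝓝 (B * (1 - 0))) :=
    ENNReal.Tendsto.const_mul (ENNReal.Tendsto.sub tendsto_const_nhds hlim (by simp))
      (Or.inr hB)
  rw [tsub_zero, mul_one] at hlim'
  refine le_of_tendsto hlim' (Eventually.of_forall fun N => ?_)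
  rw [← prob_compl_eq_one_sub (hm N)]
  refine (le_self_add.trans (key N)).trans ?_
  gcongr
  exact ENNReal.sum_le_tsum _

/-! ### The CuSum test -/

theorem measurable_cusum {Z : X → ℝ} (hZ : Measurable Z) :
    ∀ k, Measurable[obsFiltration X k] fun x => cusum Z x k
  | 0 => measurable_const
  | k + 1 => by
    have h1 := (measurable_cusum hZ k).mono ((obsFiltration X).mono k.le_succ) le_rfl
    have h2 := hZ.comp (measurable_obsFiltration_eval (X := X) k.lt_succ_self)
    exact (h1.max measurable_const).add h2

theorem isStoppingTime_cusumTest {M : ℕ} {Z : Fin M → X → ℝ} (hZ : ∀ m, Measurable (Z m)) (b : ℝ) :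
    IsStoppingTime (obsFiltration X) (cusumTest Z b) := by
  refine isStoppingTime_obsFiltration_iff.2 fun N => ?_
  have : {x | cusumTest Z b x ≤ (N : ℕ∞)} =
      ⋃ k ∈ Finset.Icc 1 N, {x | b ≤ ⨆ m, cusum (Z m) x k} := by
    ext x
    simp only [Set.mem_iUnion, Set.mem_ofPred_eq, exists_prop]
    exact cusumTest_le_iff Z b x N
  rw [this]
  refine Finset.measurableSet_biUnion _ fun k hk => ?_
  have hm : Measurable[obsFiltration X k] fun x : ℕ → X => ⨆ m, cusum (Z m) x k :=
    Measurable.iSup fun m => measurable_cusum (hZ m) k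
  exact (obsFiltration X).mono (Finset.mem_Icc.1 hk).2 _ (measurableSet_le measurable_const hm)

theorem measurable_shiryaevRoberts {Z : X → ℝ} (hZ : Measurable Z) :
    ∀ k, Measurable[obsFiltration X k] fun x => shiryaevRoberts Z x k
  | 0 => measurable_const
  | k + 1 => by
    have h1 := (measurable_shiryaevRoberts hZ k).mono ((obsFiltration X).mono k.le_succ) le_rfl
    have h2 := (Real.measurable_exp.comp hZ).ennreal_ofReal.comp
      (measurable_obsFiltration_eval (X := X) k.lt_succ_self)
    exact (measurable_const.add h1).mul h2

theorem setLIntegral_shiryaevRoberts_succ (Q : Measure X) [IsProbabilityMeasure Q] {Z : X → ℝ}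
    (hZ : Measurable Z) (hZ1 : ∫⁻ y, ENNReal.ofReal (Real.exp (Z y)) ∂Q = 1) (N : ℕ)
    {A : Set (ℕ → X)} (hA : MeasurableSet[obsFiltration X N] A) :
    ∫⁻ x in A, shiryaevRoberts Z x (N + 1) ∂(noChangeLaw Q) =
      ∫⁻ x in A, shiryaevRoberts Z x N ∂(noChangeLaw Q) + noChangeLaw Q A := by
  have hA' := (obsFiltration X).le N A hA
  have hg : Measurable[obsFiltration X N] (A.indicator fun x => 1 + shiryaevRoberts Z x N) := by
    let _ := obsFiltration X N
    exact Measurable.indicator (measurable_const.add (measurable_shiryaevRoberts hZ N)) hA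
  have h := lintegral_mul_eval (fun _ => Q) N hg (Real.measurable_exp.comp hZ).ennreal_ofReal
  simp only [Function.comp, hZ1, mul_one] at h
  rw [lintegral_indicator hA', lintegral_add_left measurable_const] at h
  rw [noChangeLaw]
  simp only [lintegral_const, MeasurableSet.univ, Measure.restrict_apply, Set.univ_inter,
    one_mul] at h
  rw [add_comm] at h
  rw [← h, ← lintegral_indicator hA']
  refine lintegral_congr fun x => ?_
  by_cases hx : x ∈ A <;> simp [hx, shiryaevRoberts]

/-- The sum over `m` of the Shiryaev–Roberts statistics has compensator growing by `M` per step and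
is at least `M * γ` at the alarm. The factor `M` cancels, which is why the threshold is `log (M *
γ)`. -/
theorem cusumTest_mem_tests (Q : Measure X) [IsProbabilityMeasure Q] {M : ℕ} (hM : 1 ≤ M)
    {Z : Fin M → X → ℝ} (hZ : ∀ m, Measurable (Z m))
    (hZ1 : ∀ m, ∫⁻ y, ENNReal.ofReal (Real.exp (Z m y)) ∂Q = 1) {γ : ℝ} (hγ : 0 < γ) :
    cusumTest Z (Real.log (M * γ)) ∈ tests Q γ := by
  refine ⟨isStoppingTime_cusumTest hZ _, ?_⟩
  have hM0 : (0 : ℝ) < M := by exact_mod_cast hM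
  have : Nonempty (Fin M) := ⟨⟨0, hM⟩⟩
  have h := le_mul_lintegral_stoppingTime (noChangeLaw Q)
    (isStoppingTime_cusumTest hZ (Real.log (M * γ))) (cusumTest_pos Z _)
    (R := fun k x => ∑ m, shiryaevRoberts (Z m) x k) (B := ENNReal.ofReal (M * γ)) (c := M)
    ENNReal.ofReal_ne_top (by simp; omega) ?_ (by simp [shiryaevRoberts]) ?_
  · rw [ENNReal.ofReal_mul hM0.le, ENNReal.ofReal_natCast] at h
    exact (ENNReal.mul_le_mul_iff_right (by simp; omega) (by simp)).1 h
  · intro N A hA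
    have hm : ∀ k m, Measurable fun x => shiryaevRoberts (Z m) x k := fun k m =>
      (measurable_shiryaevRoberts (hZ m) k).mono ((obsFiltration X).le k) le_rfl
    rw [lintegral_finsetSum _ fun m _ => hm _ m, lintegral_finsetSum _ fun m _ => hm _ m]
    simp_rw [setLIntegral_shiryaevRoberts_succ Q (hZ _) (hZ1 _) N hA]
    rw [Finset.sum_add_distrib]
    simp
  · intro x k hk
    obtain ⟨j, hj, hb⟩ := (cusumTest_le_iff Z (Real.log (M * γ)) x k).1 hk.le
    rw [Finset.mem_Icc] at hj
    -- A crossing before `k` would have stopped the test earlier, so the threshold is met at the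
    -- stopping time itself.
    have hjk : j = k := by
      have h1 := (cusumTest_le_iff Z (Real.log (M * γ)) x j).2 ⟨j, by simp [hj.1], hb⟩
      rw [hk] at h1
      have : k ≤ j := by exact_mod_cast h1
      omega
    subst hjk
    obtain ⟨i, rfl⟩ : ∃ i, j = i + 1 := ⟨j - 1, by omega⟩
    obtain ⟨m, hm⟩ := exists_eq_ciSup_of_finite (f := fun m => cusum (Z m) x (i + 1))
    rw [← hm, Real.log_le_iff_le_exp (by positivity)] at hb
    calc ENNReal.ofReal (M * γ) ≤ ENNReal.ofReal (Real.exp (cusum (Z m) x (i + 1))) := by gcongr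
      _ ≤ shiryaevRoberts (Z m) x (i + 1) := exp_cusum_le_shiryaevRoberts _ _ _
      _ ≤ _ := Finset.single_le_sum (f := fun m => shiryaevRoberts (Z m) x (i + 1))
        (fun _ _ => zero_le) (Finset.mem_univ m)

end DRCuSum

namespace DRCuSum

/-! ### Delay of the CuSum test -/

/-- The random walk with increments `Z (x N), Z (x (N + 1)), …`. -/
noncomputable def walk {X : Type*} (Z : X → ℝ) (N : ℕ) (x : ℕ → X) (j : ℕ) : ℝ :=
  ∑ i ∈ Finset.range j, Z (x (N + i))

theorem walk_succ {X : Type*} (Z : X → ℝ) (N : ℕ) (x : ℕ → X) (j : ℕ) :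
    walk Z N x (j + 1) = walk Z N x j + Z (x (N + j)) :=
  Finset.sum_range_succ _ _

/-- Taking positive parts can only raise the statistic. The bound starts after one step because
`cusum` at time `N` may be negative while the empty walk is `0`; the induction therefore passes
through the positive part. -/
theorem walk_le_cusum {X : Type*} (Z : X → ℝ) (N : ℕ) (x : ℕ → X) :
    ∀ j, walk Z N x (j + 1) ≤ cusum Z x (N + (j + 1)) := by
  have step : ∀ j, walk Z N x j ≤ max (cusum Z x (N + j)) 0 →
      walk Z N x (j + 1) ≤ cusum Z x (N + (j + 1)) := by
    intro j h
    rw [walk_succ, ← add_assoc, cusum]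
    gcongr
  intro j
  refine step j ?_
  induction j with
  | zero => simp [walk]
  | succ j ih => exact le_max_of_le_left (step j ih)

/-- The walk started after `N` observations stays below `b` during its first `j` steps. -/
def walkBelow {X : Type*} (Z : X → ℝ) (b : ℝ) (N j : ℕ) : Set (ℕ → X) :=
  {x | ∀ i ∈ Finset.Icc 1 j, walk Z N x i < b}

theorem walkBelow_succ_subset {X : Type*} (Z : X → ℝ) (b : ℝ) (N j : ℕ) :
    walkBelow Z b N (j + 1) ⊆ walkBelow Z b N j := fun _ hx i hi =>
  hx i (Finset.mem_Icc.2 ⟨(Finset.mem_Icc.1 hi).1, (Finset.mem_Icc.1 hi).2.trans j.le_succ⟩)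

theorem walk_le_of_mem_walkBelow {X : Type*} {Z : X → ℝ} {b : ℝ} (hb : 0 ≤ b) {N j : ℕ}
    {x : ℕ → X} (hx : x ∈ walkBelow Z b N j) : walk Z N x j ≤ b := by
  rcases j.eq_zero_or_pos with rfl | hj
  · simpa [walk] using hb
  · exact (hx j (Finset.mem_Icc.2 ⟨hj, le_rfl⟩)).le

/-- The test stops at the first crossing by any statistic, so the walk of a single well-chosen `m`
controls the delay. -/
theorem mem_walkBelow_of_lt_cusumTest {X : Type*} {M : ℕ} {Z : Fin M → X → ℝ} {b : ℝ} (m : Fin M)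
    {N j : ℕ} {x : ℕ → X} (h : ((N + j : ℕ) : ℕ∞) < cusumTest Z b x) :
    x ∈ walkBelow (Z m) b N j := by
  intro i hi
  by_contra hcon
  rw [not_lt] at hcon
  rw [Finset.mem_Icc] at hi
  refine absurd h (not_lt.2 ((cusumTest_le_iff Z b x (N + j)).2 ⟨N + i, ?_, ?_⟩))
  · rw [Finset.mem_Icc]; omega
  · obtain ⟨k, rfl⟩ : ∃ k, i = k + 1 := ⟨i - 1, by omega⟩
    exact (hcon.trans (walk_le_cusum (Z m) N x k)).trans
      (le_ciSup (f := fun m => cusum (Z m) x (N + (k + 1))) (Set.finite_range _).bddAbove m)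

theorem toENNReal_add_one_sub (t : ℕ∞) (N : ℕ) :
    (t : ℝ≥0∞) + 1 - ((N + 1 : ℕ) : ℝ≥0∞) =
      ∑' j : ℕ, if ((N + j : ℕ) : ℕ∞) < t then 1 else 0 := by
  have h : (t : ℝ≥0∞) + 1 - ((N + 1 : ℕ) : ℝ≥0∞) = ((t - N : ℕ∞) : ℝ≥0∞) := by
    rw [Nat.cast_add, Nat.cast_one, ENNReal.add_sub_add_eq_sub_right (by simp), ENat.toENNReal_sub]
    simp
  rw [h, toENNReal_eq_tsum]
  refine tsum_congr fun j => ?_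
  have : ((j : ℕ∞) < t - N) ↔ ((N + j : ℕ) : ℕ∞) < t := by
    rw [lt_tsub_iff_left]; push_cast; rfl
  simp only [this]

variable {X : Type*} [MeasurableSpace X]

theorem measurable_walk {Z : X → ℝ} (hZ : Measurable Z) (N j : ℕ) :
    Measurable[obsFiltration X (N + j)] fun x => walk Z N x j := by
  let _ := obsFiltration X (N + j)
  refine Finset.measurable_sum _ fun i hi => hZ.comp (measurable_obsFiltration_eval ?_)
  have := Finset.mem_range.1 hi
  omega

theorem measurableSet_walkBelow {Z : X → ℝ} (hZ : Measurable Z) (b : ℝ) (N j : ℕ) :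
    MeasurableSet[obsFiltration X (N + j)] (walkBelow Z b N j) := by
  have : walkBelow Z b N j = ⋂ i ∈ Finset.Icc 1 j, {x | walk Z N x i < b} := by
    ext x; simp [walkBelow]
  rw [this]
  refine Finset.measurableSet_biInter _ fun i hi => ?_
  refine (obsFiltration X).mono (Nat.add_le_add_left (Finset.mem_Icc.1 hi).2 N) _ ?_
  exact measurableSet_lt (measurable_walk hZ N i) measurable_const

/-- Wald's bound on the expected first passage time over `b` of a walk whose increments are at
most `K` and have mean at least `I`. -/
theorem tsum_measure_walkBelow_le (μ : ℕ → Measure X) [∀ i, IsProbabilityMeasure (μ i)]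
    (P : Measure X) [IsProbabilityMeasure P] {N : ℕ} (hμ : ∀ j, μ (N + j) = P)
    {Z : X → ℝ} (hZ : Measurable Z) {b K I : ℝ} (hb : 0 ≤ b) (hI : 0 < I)
    (hZK : ∀ y, Z y ≤ K) (hInt : Integrable Z P) (hmean : I ≤ ∫ y, Z y ∂P)
    {A : Set (ℕ → X)} (hA : MeasurableSet[obsFiltration X N] A) :
    ∑' j, Measure.infinitePi μ (A ∩ walkBelow Z b N j) ≤
      ENNReal.ofReal ((b + K) / I) * Measure.infinitePi μ A := by
  set ρ := Measure.infinitePi μ with hρ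
  have hmeanK : ∫ y, Z y ∂P ≤ K := by
    have := integral_mono hInt (integrable_const K) hZK
    simpa using this
  have hADF : ∀ j, MeasurableSet[obsFiltration X (N + j)] (A ∩ walkBelow Z b N j) := fun j =>
    ((obsFiltration X).mono (Nat.le_add_right N j) _ hA).inter (measurableSet_walkBelow hZ b N j)
  have hAD : ∀ j, MeasurableSet (A ∩ walkBelow Z b N j) := fun j =>
    (obsFiltration X).le _ _ (hADF j)
  have hwm : ∀ j, Measurable fun x => walk Z N x j := fun j =>
    (measurable_walk hZ N j).mono ((obsFiltration X).le _) le_rfl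
  have hKZ : ∫⁻ y, ENNReal.ofReal (K - Z y) ∂P = ENNReal.ofReal (K - ∫ y, Z y ∂P) := by
    rw [← ofReal_integral_eq_lintegral_ofReal (f := fun y => K - Z y) ((integrable_const K).sub hInt)
      (Eventually.of_forall fun y => sub_nonneg.2 (hZK y)), integral_sub (integrable_const K) hInt]
    simp
  -- The potential `b + K - walk` loses at least `I` in mean at each step started while the walk is
  -- below `b`. The allowance `K` covers the overshoot: at a crossing the potential is still
  -- nonnegative, so paths that cross may be discarded.
  have key : ∀ J : ℕ, ENNReal.ofReal I * ∑ j ∈ Finset.range J, ρ (A ∩ walkBelow Z b N j) +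
      ∫⁻ x in A ∩ walkBelow Z b N J, ENNReal.ofReal (b + K - walk Z N x J) ∂ρ ≤
      ENNReal.ofReal (b + K) * ρ A := by
    intro J
    induction J with
    | zero =>
      have h0 : walkBelow Z b N 0 = Set.univ := by ext x; simp [walkBelow]
      simp [h0, walk]
    | succ J ih =>
      refine le_trans ?_ ih
      rw [Finset.sum_range_succ, mul_add, add_assoc]
      gcongr
      have h1 : ∫⁻ x in A ∩ walkBelow Z b N (J + 1), ENNReal.ofReal (b + K - walk Z N x (J + 1)) ∂ρ
          ≤ ∫⁻ x in A ∩ walkBelow Z b N J, ENNReal.ofReal (b - walk Z N x J) ∂ρ +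
            ρ (A ∩ walkBelow Z b N J) * ENNReal.ofReal (K - ∫ y, Z y ∂P) := by
        calc _ ≤ ∫⁻ x in A ∩ walkBelow Z b N J, ENNReal.ofReal (b + K - walk Z N x (J + 1)) ∂ρ :=
              lintegral_mono_set (Set.inter_subset_inter_right _ (walkBelow_succ_subset Z b N J))
          _ = ∫⁻ x in A ∩ walkBelow Z b N J, (ENNReal.ofReal (b - walk Z N x J) +
                ENNReal.ofReal (K - Z (x (N + J)))) ∂ρ := by
              refine setLIntegral_congr_fun (hAD J) fun x hx => ?_
              have := walk_le_of_mem_walkBelow hb hx.2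
              rw [← ENNReal.ofReal_add (by linarith) (by linarith [hZK (x (N + J))]), walk_succ]
              congr 1; ring
          _ = _ := by
              rw [lintegral_add_left (by exact (measurable_const.sub (hwm J)).ennreal_ofReal),
                hρ, setLIntegral_eval μ (N + J) (hADF J) (h := fun y => ENNReal.ofReal (K - Z y))
                (measurable_const.sub hZ).ennreal_ofReal, hμ, hKZ]
      have h2 : ∫⁻ x in A ∩ walkBelow Z b N J, ENNReal.ofReal (b + K - walk Z N x J) ∂ρ =
          ∫⁻ x in A ∩ walkBelow Z b N J, ENNReal.ofReal (b - walk Z N x J) ∂ρ +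
            ρ (A ∩ walkBelow Z b N J) * ENNReal.ofReal K := by
        have : ∀ x ∈ A ∩ walkBelow Z b N J, ENNReal.ofReal (b + K - walk Z N x J) =
            ENNReal.ofReal (b - walk Z N x J) + ENNReal.ofReal K := by
          intro x hx
          have := walk_le_of_mem_walkBelow hb hx.2
          rw [← ENNReal.ofReal_add (by linarith) (by linarith)]
          congr 1; ring
        rw [setLIntegral_congr_fun (hAD J) this,
          lintegral_add_left (by exact (measurable_const.sub (hwm J)).ennreal_ofReal),
          setLIntegral_const, mul_comm (ENNReal.ofReal K)]
      rw [h2]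
      calc _ ≤ ENNReal.ofReal I * ρ (A ∩ walkBelow Z b N J) +
            (∫⁻ x in A ∩ walkBelow Z b N J, ENNReal.ofReal (b - walk Z N x J) ∂ρ +
            ρ (A ∩ walkBelow Z b N J) * ENNReal.ofReal (K - ∫ y, Z y ∂P)) := by gcongr
        _ = ∫⁻ x in A ∩ walkBelow Z b N J, ENNReal.ofReal (b - walk Z N x J) ∂ρ +
            ρ (A ∩ walkBelow Z b N J) *
              (ENNReal.ofReal I + ENNReal.ofReal (K - ∫ y, Z y ∂P)) := by ring
        _ ≤ _ := by
            gcongr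
            rw [← ENNReal.ofReal_add hI.le (by linarith)]
            exact ENNReal.ofReal_le_ofReal (by linarith)
  have hsum : ENNReal.ofReal I * ∑' j, ρ (A ∩ walkBelow Z b N j) ≤ ENNReal.ofReal (b + K) * ρ A := by
    rw [← ENNReal.tsum_mul_left]
    refine ENNReal.tsum_le_of_sum_range_le fun J => ?_
    rw [← Finset.mul_sum]
    exact le_self_add.trans (key J)
  rw [ENNReal.ofReal_div_of_pos hI, ← ENNReal.mul_div_right_comm]
  rw [ENNReal.le_div_iff_mul_le (by simp [hI]) (by simp), mul_comm]
  exact hsum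

/-- The bound is uniform in the change point and in the past because the walk uses only observations
after the change, which are independent of that past. -/
theorem WADD_cusumTest_le (Q P : Measure X) [IsProbabilityMeasure Q] [IsProbabilityMeasure P]
    {M : ℕ} {Z : Fin M → X → ℝ} (m : Fin M) (hZ : Measurable (Z m)) {b K I : ℝ} (hb : 0 ≤ b)
    (hI : 0 < I) (hZK : ∀ y, Z m y ≤ K) (hInt : Integrable (Z m) P)
    (hmean : I ≤ ∫ y, Z m y ∂P) :
    WADD Q P (cusumTest Z b) ≤ ENNReal.ofReal ((b + K) / I) := by
  refine iSup₂_le fun ν hν => ?_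
  obtain ⟨N, rfl⟩ : ∃ N, ν = N + 1 := ⟨ν - 1, by omega⟩
  refine essSup_condLExp_le ((obsFiltration X).le _) fun A hA => ?_
  rw [Nat.add_sub_cancel] at hA
  have hA' := (obsFiltration X).le _ _ hA
  have := isProbabilityMeasure_ite Q P (N + 1)
  have hDm : ∀ j, MeasurableSet (walkBelow (Z m) b N j) := fun j =>
    (obsFiltration X).le _ _ (measurableSet_walkBelow hZ b N j)
  refine le_trans ?_ (tsum_measure_walkBelow_le (fun k => if k + 1 < N + 1 then Q else P) P
    (N := N) (by simp) hZ hb hI hZK hInt hmean hA)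
  calc ∫⁻ x in A, ((cusumTest Z b x : ℝ≥0∞) + 1 - ((N + 1 : ℕ) : ℝ≥0∞)) ∂(changeLaw Q P (N + 1))
      ≤ ∫⁻ x in A, ∑' j, (walkBelow (Z m) b N j).indicator (fun _ => 1) x
          ∂(changeLaw Q P (N + 1)) := by
        refine lintegral_mono fun x => ?_
        rw [toENNReal_add_one_sub]
        refine ENNReal.tsum_le_tsum fun j => ?_
        split_ifs with h
        · rw [Set.indicator_of_mem (mem_walkBelow_of_lt_cusumTest m h)]
        · exact zero_le
    _ = _ := by
        rw [lintegral_tsum fun j => (measurable_const.indicator (hDm j)).aemeasurable]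
        refine tsum_congr fun j => ?_
        rw [lintegral_indicator (hDm j), setLIntegral_one, Measure.restrict_apply (hDm j),
          Set.inter_comm, changeLaw]

end DRCuSum

namespace DRCuSum

variable {X : Type*} [MeasurableSpace X]

/-! ### Lower bound on the delay -/

theorem setLIntegral_prod_eval (μ : ℕ → Measure X) [∀ i, IsProbabilityMeasure (μ i)]
    {P : Measure X} {N : ℕ} (hμ : ∀ j, μ (N + j) = P) {h : X → ℝ≥0∞} (hh : Measurable h)
    {A : Set (ℕ → X)} (hA : MeasurableSet[obsFiltration X N] A) (k : ℕ) :
    ∫⁻ x in A, ∏ i ∈ Finset.range k, h (x (N + i)) ∂(Measure.infinitePi μ) =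
      Measure.infinitePi μ A * (∫⁻ y, h y ∂P) ^ k := by
  have hA' := (obsFiltration X).le N A hA
  induction k with
  | zero => simp
  | succ k ih =>
    have hg : Measurable[obsFiltration X (N + k)]
        (A.indicator fun x => ∏ i ∈ Finset.range k, h (x (N + i))) := by
      have hAk := (obsFiltration X).mono (Nat.le_add_right N k) _ hA
      let _ := obsFiltration X (N + k)
      refine Measurable.indicator (Finset.measurable_prod _ fun i hi =>
        hh.comp (measurable_obsFiltration_eval ?_)) hAk
      have := Finset.mem_range.1 hi
      omega
    have := lintegral_mul_eval μ (N + k) hg hh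
    rw [lintegral_indicator hA', ih, hμ] at this
    rw [pow_succ, ← mul_assoc, ← this, ← lintegral_indicator hA']
    refine lintegral_congr fun x => ?_
    by_cases hx : x ∈ A <;> simp [hx, Finset.prod_range_succ]

/-- Positive exponents are harmless because `Z` is bounded above; negative ones down to `-1` because
$\int e^{-Z}\,dP=\int 1\,dQ$. This makes the moment generating function differentiable at `0`, both
for the Chernoff bound and for complementary slackness. -/
theorem zero_mem_interior_integrableExpSet (Q : Measure X) [IsProbabilityMeasure Q] {Z : X → ℝ}
    (hZ : Measurable Z) {K : ℝ} (hZK : ∀ y, Z y ≤ K)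
    [IsProbabilityMeasure (Q.withDensity fun y => ENNReal.ofReal (Real.exp (Z y)))] (a : ℝ) :
    (0 : ℝ) ∈ interior (integrableExpSet (fun y => Z y - a)
      (Q.withDensity fun y => ENNReal.ofReal (Real.exp (Z y)))) := by
  set P := Q.withDensity fun y => ENNReal.ofReal (Real.exp (Z y)) with hP
  have hneg : Integrable (fun y => Real.exp (-Z y)) P := by
    refine ⟨by fun_prop, ?_⟩
    rw [hasFiniteIntegral_iff_ofReal (Eventually.of_forall fun y => (Real.exp_pos _).le), hP,
      lintegral_withDensity_eq_lintegral_mul _ (by fun_prop) (by fun_prop)]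
    simp only [Pi.mul_apply]
    have : ∀ y, ENNReal.ofReal (Real.exp (Z y)) * ENNReal.ofReal (Real.exp (-Z y)) = 1 := by
      intro y
      rw [← ENNReal.ofReal_mul (Real.exp_pos _).le, ← Real.exp_add]
      simp
    simp [this]
  have hset : Set.Ioo (-1 : ℝ) 1 ⊆ integrableExpSet (fun y => Z y - a) P := by
    intro t ht
    rcases le_or_gt 0 t with h | h
    · refine Integrable.of_bound (C := Real.exp (t * (K - a))) (by fun_prop)
        (Eventually.of_forall fun y => ?_)
      rw [Real.norm_of_nonneg (Real.exp_pos _).le]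
      gcongr
      exact sub_le_sub_right (hZK y) a
    · refine Integrable.mono' (((integrable_const (1 : ℝ)).add hneg).const_mul (Real.exp (-t * a)))
        (by fun_prop) (Eventually.of_forall fun y => ?_)
      rw [Real.norm_of_nonneg (Real.exp_pos _).le, mul_sub, sub_eq_add_neg, Real.exp_add, mul_comm,
        neg_mul]
      gcongr
      simp only [Pi.add_apply]
      rcases le_or_gt 0 (Z y) with hy | hy
      · have : Real.exp (t * Z y) ≤ 1 := Real.exp_le_one_iff.2 (by nlinarith)
        linarith [Real.exp_pos (-Z y)]
      · have : Real.exp (t * Z y) ≤ Real.exp (-Z y) := by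
          gcongr; nlinarith [ht.1]
        linarith
  exact interior_maximal hset isOpen_Ioo (by simp)

/-- A strict exponential moment bound above the mean of a log-likelihood ratio that is bounded
above. -/
theorem exists_lintegral_exp_lt_one (Q : Measure X) [IsProbabilityMeasure Q] {Z : X → ℝ}
    (hZ : Measurable Z) {K : ℝ} (hZK : ∀ y, Z y ≤ K)
    [IsProbabilityMeasure (Q.withDensity fun y => ENNReal.ofReal (Real.exp (Z y)))] {a : ℝ}
    (ha : ∫ y, Z y ∂(Q.withDensity fun y => ENNReal.ofReal (Real.exp (Z y))) < a)
    (hInt : Integrable Z (Q.withDensity fun y => ENNReal.ofReal (Real.exp (Z y)))) :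
    ∃ θ : ℝ, 0 < θ ∧ ∫⁻ y, ENNReal.ofReal (Real.exp (θ * (Z y - a)))
      ∂(Q.withDensity fun y => ENNReal.ofReal (Real.exp (Z y))) < 1 := by
  have h0 := zero_mem_interior_integrableExpSet Q hZ hZK a
  set P := Q.withDensity fun y => ENNReal.ofReal (Real.exp (Z y)) with hP
  have hder := hasDerivAt_mgf h0
  have hneg' : ∫ y, (Z y - a) ∂P < 0 := by
    rw [integral_sub hInt (integrable_const a)]; simpa using ha
  simp only [zero_mul, Real.exp_zero, mul_one] at hder
  -- The moment generating function equals `1` at `0` with negative slope there, hence is below `1`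
  -- at some small `θ > 0`.
  have hev := (hder.tendsto_slope_zero_right.eventually (gt_mem_nhds hneg')).and
    (nhdsWithin_le_nhds (mem_interior_iff_mem_nhds.1 h0))
  obtain ⟨θ, ⟨hθ, hexp⟩, hθpos⟩ := (hev.and self_mem_nhdsWithin).exists
  have hθpos : 0 < θ := hθpos
  refine ⟨θ, hθpos, ?_⟩
  rw [zero_add, mgf_zero, smul_eq_mul] at hθ
  have hlt : mgf (fun y => Z y - a) P θ < 1 := by
    by_contra hcon
    have : 0 ≤ θ⁻¹ * (mgf (fun y => Z y - a) P θ - 1) :=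
      mul_nonneg (inv_pos.2 hθpos).le (by linarith)
    linarith
  rw [← ofReal_integral_eq_lintegral_ofReal hexp
    (Eventually.of_forall fun y => (Real.exp_pos _).le)]
  exact ENNReal.ofReal_lt_one.2 hlt

/-- A given stopping time lies in at most `k` of the windows `(N, N + k]`. Summed over all change
points, alarms within `k` steps therefore cost at most `k`, whatever the test. -/
theorem tsum_measure_window_le (μ : Measure (ℕ → X)) [IsProbabilityMeasure μ]
    {τ : (ℕ → X) → ℕ∞} (hτ : IsStoppingTime (obsFiltration X) τ) (k : ℕ) :
    ∑' N : ℕ, μ ({x | (N : ℕ∞) < τ x} ∩ {x | τ x ≤ ((N + k : ℕ) : ℕ∞)}) ≤ k := by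
  have hm : ∀ j : ℕ, MeasurableSet {x | τ x = (j : ℕ∞)} := by
    intro j
    have h1 : {x | τ x = ((j : ℕ) : ℕ∞)} = {x | τ x ≤ (j : ℕ∞)} \ ⋃ i ∈ Finset.range j,
        {x | τ x ≤ (i : ℕ∞)} := by
      ext x
      simp only [Set.mem_ofPred_eq, Set.mem_sdiff, Set.mem_iUnion, Finset.mem_range, not_exists,
        exists_prop, not_and, not_le]
      constructor
      · intro h
        refine ⟨h.le, fun i hi => ?_⟩
        rw [h]; exact_mod_cast hi
      · rintro ⟨h1, h2⟩
        refine le_antisymm h1 ?_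
        by_contra hlt
        rw [not_le] at hlt
        obtain ⟨i, hi⟩ := ENat.ne_top_iff_exists.1 (ne_top_of_lt hlt)
        rw [← hi] at hlt h2
        exact lt_irrefl _ (h2 i (by exact_mod_cast hlt))
    have hle : ∀ i : ℕ, MeasurableSet {x | τ x ≤ (i : ℕ∞)} := fun i =>
      (obsFiltration X).le i _ (isStoppingTime_obsFiltration_iff.1 hτ i)
    rw [h1]
    exact (hle j).diff (Finset.measurableSet_biUnion _ fun i _ => hle i)
  have hsub : ∀ N : ℕ, μ ({x | (N : ℕ∞) < τ x} ∩ {x | τ x ≤ ((N + k : ℕ) : ℕ∞)}) ≤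
      ∑ i ∈ Finset.range k, μ {x | τ x = ((N + i + 1 : ℕ) : ℕ∞)} := by
    intro N
    refine (measure_mono ?_).trans (measure_biUnion_finset_le (Finset.range k) _)
    rintro x ⟨h1, h2⟩
    simp only [Set.mem_ofPred_eq] at h1 h2
    obtain ⟨t, ht⟩ := ENat.ne_top_iff_exists.1 (ne_top_of_le_ne_top (ENat.natCast_ne_top _) h2)
    rw [← ht] at h1 h2
    have h1 : N < t := by exact_mod_cast h1
    have h2 : t ≤ N + k := by exact_mod_cast h2
    simp only [Set.mem_iUnion, Finset.mem_range, Set.mem_ofPred_eq, exists_prop]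
    refine ⟨t - N - 1, by omega, ?_⟩
    rw [← ht]
    congr 1; omega
  calc _ ≤ ∑' N : ℕ, ∑ i ∈ Finset.range k, μ {x | τ x = ((N + i + 1 : ℕ) : ℕ∞)} :=
        ENNReal.tsum_le_tsum hsub
    _ = ∑ i ∈ Finset.range k, ∑' N : ℕ, μ {x | τ x = ((N + i + 1 : ℕ) : ℕ∞)} :=
        Summable.tsum_finsetSum fun _ _ => ENNReal.summable
    _ ≤ ∑ i ∈ Finset.range k, 1 := by
        refine Finset.sum_le_sum fun i _ => ?_
        rw [← measure_iUnion ?_ fun N => hm _]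
        · exact prob_le_one
        · intro N N' hNN
          refine Set.disjoint_left.2 fun x hx hx' => hNN ?_
          simp only [Set.mem_ofPred_eq] at hx hx'
          rw [hx] at hx'
          have : N + i + 1 = N' + i + 1 := by exact_mod_cast hx'
          omega
    _ = k := by simp

/-- The delay of a test with at least `γ` expected observations before a false alarm; `ρ` bounds
the exponential moment of the increments of the log-likelihood ratio centered at `a`. -/
theorem le_WADD_add (Q : Measure X) [IsProbabilityMeasure Q] {Z : X → ℝ} (hZ : Measurable Z)
    {P : Measure X} (hP : P = Q.withDensity fun y => ENNReal.ofReal (Real.exp (Z y)))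
    [IsProbabilityMeasure P] {a θ : ℝ} (hθ : 0 < θ) {ρ : ℝ≥0∞}
    (hρ : ∫⁻ y, ENNReal.ofReal (Real.exp (θ * (Z y - a))) ∂P = ρ) {γ : ℝ} (hγ : 0 < γ)
    {τ : (ℕ → X) → ℕ∞} (hτ : τ ∈ tests Q γ) (k : ℕ) :
    ((k : ℝ≥0∞) + 1) ≤ WADD Q P τ +
      (k + 1) * (ρ ^ k + ENNReal.ofReal (2 * k * Real.exp (a * k) / γ)) := by
  obtain ⟨hτs, hτγ⟩ := hτ
  set D := WADD Q P τ with hD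
  set p : ℕ → ℝ≥0∞ := fun N => noChangeLaw Q {x | (N : ℕ∞) < τ x} with hp
  set e : ℕ → ℝ≥0∞ := fun N =>
    noChangeLaw Q ({x | (N : ℕ∞) < τ x} ∩ {x | τ x ≤ ((N + k : ℕ) : ℕ∞)}) with he
  -- With the change after `N` observations, `{N < τ}` splits three ways: no alarm for `k` steps,
  -- charged to the delay; log-likelihood ratio above `a * k`, rare by Chernoff; or an alarm with
  -- ratio at most `a * k`, whose probability is at most `exp (a * k)` times that under `Q`. The
  -- event `{N < τ}` depends only on the first `N` observations, so it has the same probability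
  -- under both laws.
  have hstep : ∀ N, ((k : ℝ≥0∞) + 1) * p N ≤
      D * p N + (k + 1) * (ρ ^ k * p N + ENNReal.ofReal (Real.exp (a * k)) * e N) := by
    intro N
    set A := {x | (N : ℕ∞) < τ x} with hA
    set B := {x | τ x ≤ ((N + k : ℕ) : ℕ∞)} with hB
    set L := {x : ℕ → X | walk Z N x k ≤ a * k} with hL
    have hAF : MeasurableSet[obsFiltration X N] A := measurableSet_lt_stoppingTime hτs N
    have hAFk : MeasurableSet[obsFiltration X (N + k)] A :=
      (obsFiltration X).mono (Nat.le_add_right N k) _ hAF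
    have hBF : MeasurableSet[obsFiltration X (N + k)] B :=
      isStoppingTime_obsFiltration_iff.1 hτs (N + k)
    have hLF : MeasurableSet[obsFiltration X (N + k)] L :=
      measurableSet_le (measurable_walk hZ N k) measurable_const
    have hAm := (obsFiltration X).le _ _ hAF
    have hBm := (obsFiltration X).le _ _ hBF
    have hLm := (obsFiltration X).le _ _ hLF
    set μ := changeLaw Q P (N + 1) with hμ
    have hdm : Measurable fun y => ENNReal.ofReal (Real.exp (Z y)) := by fun_prop
    have hμA : μ A = p N := by
      subst hP
      rw [hμ, changeLaw_apply Q hdm N 0 (by simpa using hAF)]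
      simp [hp, hA]
    have hμL : μ ((A ∩ B) ∩ L) ≤ ENNReal.ofReal (Real.exp (a * k)) * e N := by
      have hP' := hP
      subst hP'
      rw [hμ, changeLaw_apply Q hdm N k ((hAFk.inter hBF).inter hLF)]
      calc _ ≤ ∫⁻ x in A ∩ B ∩ L, ENNReal.ofReal (Real.exp (a * k)) ∂(noChangeLaw Q) := by
            refine setLIntegral_mono' ((hAm.inter hBm).inter hLm) fun x hx => ?_
            rw [← ENNReal.ofReal_prod_of_nonneg fun i _ => (Real.exp_pos _).le, ← Real.exp_sum]
            exact ENNReal.ofReal_le_ofReal (Real.exp_le_exp.2 hx.2)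
        _ ≤ _ := by
            rw [setLIntegral_const]
            gcongr
            exact measure_mono Set.inter_subset_left
    have hμLc : μ (A ∩ Lᶜ) ≤ ρ ^ k * p N := by
      have := isProbabilityMeasure_ite Q P (N + 1)
      have hprod := setLIntegral_prod_eval (fun k => if k + 1 < N + 1 then Q else P) (P := P)
        (N := N) (by simp) (h := fun y => ENNReal.ofReal (Real.exp (θ * (Z y - a))))
        (by fun_prop) hAF k
      rw [hρ, mul_comm] at hprod
      change _ = ρ ^ k * μ A at hprod
      rw [hμA] at hprod
      rw [← hprod, ← setLIntegral_one]
      calc _ ≤ ∫⁻ x in A ∩ Lᶜ, ∏ i ∈ Finset.range k,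
            ENNReal.ofReal (Real.exp (θ * (Z (x (N + i)) - a))) ∂μ := by
            refine setLIntegral_mono' (hAm.inter hLm.compl) fun x hx => ?_
            rw [← ENNReal.ofReal_prod_of_nonneg fun i _ => (Real.exp_pos _).le, ← Real.exp_sum,
              ← Finset.mul_sum, Finset.sum_sub_distrib]
            have h1 : a * k < walk Z N x k := not_le.1 hx.2
            rw [walk] at h1
            rw [ENNReal.one_le_ofReal, Real.one_le_exp_iff]
            refine mul_nonneg hθ.le ?_
            simp only [Finset.sum_const, Finset.card_range, nsmul_eq_mul]
            linarith
        _ ≤ _ := lintegral_mono_set Set.inter_subset_left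
    have hdelay : ((k : ℝ≥0∞) + 1) * μ (A ∩ Bᶜ) ≤ D * p N := by
      have h1 := setLIntegral_le_essSup_condLExp ((obsFiltration X).le N) (μ := μ)
        (f := fun x => (τ x : ℝ≥0∞) + 1 - ((N + 1 : ℕ) : ℝ≥0∞)) hAF
      rw [hμA] at h1
      have h2 : essSup (condLExp (obsFiltration X N) μ
          (fun x => (τ x : ℝ≥0∞) + 1 - ((N + 1 : ℕ) : ℝ≥0∞))) μ ≤ D :=
        le_iSup₂ (f := fun (ν : ℕ) (_ : 1 ≤ ν) =>
          essSup (condLExp (obsFiltration X (ν - 1)) (changeLaw Q P ν)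
            (fun x => (τ x : ℝ≥0∞) + 1 - (ν : ℝ≥0∞))) (changeLaw Q P ν)) (N + 1) (by omega)
      refine le_trans ?_ (h1.trans (by gcongr))
      calc ((k : ℝ≥0∞) + 1) * μ (A ∩ Bᶜ) = ∫⁻ x in A ∩ Bᶜ, ((k : ℝ≥0∞) + 1) ∂μ := by
            rw [setLIntegral_const]
        _ ≤ ∫⁻ x in A ∩ Bᶜ, ((τ x : ℝ≥0∞) + 1 - ((N + 1 : ℕ) : ℝ≥0∞)) ∂μ := by
            refine setLIntegral_mono' (hAm.inter hBm.compl) fun x hx => ?_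
            have h3 : ((N + k : ℕ) : ℕ∞) < τ x := not_le.1 hx.2
            have h4 : ((N + k + 1 : ℕ) : ℕ∞) ≤ τ x := by
              have := Order.add_one_le_of_lt h3
              exact_mod_cast this
            have h5 : ((N + k + 1 : ℕ) : ℝ≥0∞) ≤ (τ x : ℝ≥0∞) := by
              have := ENat.toENNReal_le.2 h4
              simpa using this
            refine ENNReal.le_sub_of_add_le_right (by simp) ?_
            calc (k : ℝ≥0∞) + 1 + ((N + 1 : ℕ) : ℝ≥0∞) = ((N + k + 1 : ℕ) : ℝ≥0∞) + 1 := by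
                  push_cast; ring
              _ ≤ _ := by gcongr
        _ ≤ _ := lintegral_mono_set Set.inter_subset_left
    have hcover : p N ≤ μ (A ∩ Bᶜ) + (μ (A ∩ Lᶜ) + μ ((A ∩ B) ∩ L)) := by
      rw [← hμA]
      refine (measure_mono (t := (A ∩ Bᶜ) ∪ ((A ∩ Lᶜ) ∪ ((A ∩ B) ∩ L))) ?_).trans
        ((measure_union_le _ _).trans (by gcongr; exact measure_union_le _ _))
      intro x hx
      simp only [Set.mem_union, Set.mem_inter_iff, Set.mem_compl_iff]
      tauto
    calc ((k : ℝ≥0∞) + 1) * p N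
        ≤ (k + 1) * (μ (A ∩ Bᶜ) + (μ (A ∩ Lᶜ) + μ ((A ∩ B) ∩ L))) := by gcongr
      _ = (k + 1) * μ (A ∩ Bᶜ) + (k + 1) * (μ (A ∩ Lᶜ) + μ ((A ∩ B) ∩ L)) := by ring
      _ ≤ _ := by gcongr
  have hsumγ : ENNReal.ofReal γ ≤ ∑' N, p N := by
    rwa [lintegral_stoppingTime _ hτs] at hτγ
  -- The full sum may be infinite, so a finite partial sum above `γ / 2` serves as the normalizer;
  -- this is the source of the factor `2`.
  obtain ⟨n, hn⟩ : ∃ n, ENNReal.ofReal (γ / 2) < ∑ N ∈ Finset.range n, p N := by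
    have h1 : ENNReal.ofReal (γ / 2) < ∑' N, p N :=
      lt_of_lt_of_le ((ENNReal.ofReal_lt_ofReal_iff hγ).2 (by linarith)) hsumγ
    exact ((ENNReal.tendsto_nat_tsum p).eventually (lt_mem_nhds h1)).exists
  set S := ∑ N ∈ Finset.range n, p N with hS
  have hStop : S ≠ ∞ := by
    rw [hS]; exact (ENNReal.sum_lt_top.2 fun N _ => measure_lt_top _ _).ne
  have hS0 : S ≠ 0 := (lt_of_le_of_lt zero_le hn).ne'
  have hE : ∑ N ∈ Finset.range n, e N ≤ k :=
    (ENNReal.sum_le_tsum _).trans (tsum_measure_window_le (noChangeLaw Q) hτs k)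
  have hmain : ((k : ℝ≥0∞) + 1) * S ≤
      (D + (k + 1) * ρ ^ k) * S + (k + 1) * (ENNReal.ofReal (Real.exp (a * k)) * k) := by
    calc ((k : ℝ≥0∞) + 1) * S = ∑ N ∈ Finset.range n, ((k : ℝ≥0∞) + 1) * p N := by
          rw [Finset.mul_sum]
      _ ≤ ∑ N ∈ Finset.range n, (D * p N +
          (k + 1) * (ρ ^ k * p N + ENNReal.ofReal (Real.exp (a * k)) * e N)) :=
          Finset.sum_le_sum fun N _ => hstep N
      _ = (D + (k + 1) * ρ ^ k) * S +
          (k + 1) * (ENNReal.ofReal (Real.exp (a * k)) * ∑ N ∈ Finset.range n, e N) := by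
          rw [Finset.sum_add_distrib, ← Finset.mul_sum, ← Finset.mul_sum, Finset.sum_add_distrib,
            ← Finset.mul_sum, ← Finset.mul_sum]
          ring
      _ ≤ _ := by gcongr
  have hdiv : ((k : ℝ≥0∞) + 1) ≤
      D + (k + 1) * ρ ^ k + (k + 1) * (ENNReal.ofReal (Real.exp (a * k)) * k) / S := by
    rw [← ENNReal.mul_le_mul_iff_left hS0 hStop, add_mul (D + _) _ S, ENNReal.div_mul_cancel hS0 hStop]
    exact hmain
  refine hdiv.trans ?_
  rw [mul_add, ← add_assoc, mul_div_assoc]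
  gcongr
  calc ENNReal.ofReal (Real.exp (a * k)) * k / S
      ≤ ENNReal.ofReal (Real.exp (a * k)) * k / ENNReal.ofReal (γ / 2) := by gcongr
    _ = _ := by
      rw [← ENNReal.ofReal_natCast, ← ENNReal.ofReal_mul (Real.exp_pos _).le,
        ← ENNReal.ofReal_div_of_pos (by linarith)]
      congr 1
      field_simp

theorem eventually_le_WADD (Q : Measure X) [IsProbabilityMeasure Q] {Z : X → ℝ}
    (hZ : Measurable Z) {P : Measure X}
    (hP : P = Q.withDensity fun y => ENNReal.ofReal (Real.exp (Z y)))
    [IsProbabilityMeasure P] {K : ℝ} (hZK : ∀ y, Z y ≤ K) (hInt : Integrable Z P)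
    (hI : 0 < ∫ y, Z y ∂P) {c : ℝ} (hc : 0 < c) (hcI : c * ∫ y, Z y ∂P < 1) :
    ∀ᶠ γ : ℝ in atTop, ∀ τ ∈ tests Q γ, ENNReal.ofReal (c * Real.log γ) ≤ WADD Q P τ := by
  set I := ∫ y, Z y ∂P with hIdef
  obtain ⟨a, haI, hca⟩ : ∃ a, I < a ∧ c * a < 1 := by
    obtain ⟨a, h1, h2⟩ := exists_between (show I < 1 / c by rw [lt_div_iff₀ hc]; linarith)
    exact ⟨a, h1, by rw [lt_div_iff₀ hc] at h2; linarith⟩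
  have ha : 0 < a := hI.trans haI
  -- One factor `1 - δ` is spent on shortening the window, the other on the error terms;
  -- $(1-\delta)^2\ge 1-2\delta=ca$.
  obtain ⟨δ, hδ0, hδ1, hδ⟩ : ∃ δ : ℝ, 0 < δ ∧ δ < 1 ∧ c * a ≤ (1 - δ) * (1 - δ) := by
    refine ⟨(1 - c * a) / 2, by linarith, by nlinarith, ?_⟩
    nlinarith [mul_pos hc ha]
  obtain ⟨θ, hθ, hρ1⟩ : ∃ θ : ℝ, 0 < θ ∧
      ∫⁻ y, ENNReal.ofReal (Real.exp (θ * (Z y - a))) ∂P < 1 := by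
    subst hP
    exact exists_lintegral_exp_lt_one Q hZ hZK haI hInt
  set ρ := ∫⁻ y, ENNReal.ofReal (Real.exp (θ * (Z y - a))) ∂P with hρ
  -- With this window length `exp (a * k)` is at most `γ ^ (1 - δ)`, so the false-alarm term is of
  -- order `log γ / γ ^ δ`.
  have hk : Tendsto (fun γ : ℝ => ⌊(1 - δ) * Real.log γ / a⌋₊) atTop atTop := by
    refine tendsto_nat_floor_atTop.comp ?_
    refine Tendsto.atTop_div_const ha ?_
    exact Tendsto.const_mul_atTop (by linarith) Real.tendsto_log_atTop
  have h1 : Tendsto (fun γ : ℝ => ρ ^ ⌊(1 - δ) * Real.log γ / a⌋₊) atTop (𝓝 0) :=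
    (ENNReal.tendsto_pow_atTop_nhds_zero_of_lt_one hρ1).comp hk
  have h2 : Tendsto (fun γ : ℝ => 2 * (1 - δ) / a * (Real.log γ / γ ^ δ)) atTop (𝓝 0) := by
    have := ((isLittleO_log_rpow_atTop hδ0).tendsto_div_nhds_zero).const_mul (2 * (1 - δ) / a)
    simpa using this
  have h1' : ∀ᶠ γ : ℝ in atTop, ρ ^ ⌊(1 - δ) * Real.log γ / a⌋₊ ≤ ENNReal.ofReal (δ / 2) :=
    (h1.eventually (gt_mem_nhds (by simpa using hδ0))).mono fun _ h => h.le
  have h2' : ∀ᶠ γ : ℝ in atTop, 2 * (1 - δ) / a * (Real.log γ / γ ^ δ) ≤ δ / 2 :=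
    (h2.eventually (gt_mem_nhds (by linarith))).mono fun _ h => h.le
  filter_upwards [h1', h2', eventually_gt_atTop 1] with γ hγ1 hγ2 hγ τ hτ
  have hγ0 : 0 < γ := by linarith
  have hlog : 0 < Real.log γ := Real.log_pos hγ
  set k := ⌊(1 - δ) * Real.log γ / a⌋₊ with hkdef
  have hkle : (k : ℝ) ≤ (1 - δ) * Real.log γ / a :=
    Nat.floor_le (div_nonneg (mul_nonneg (by linarith) hlog.le) ha.le)
  have hklt : (1 - δ) * Real.log γ / a < k + 1 := Nat.lt_floor_add_one _
  have hmain := le_WADD_add Q hZ hP hθ hρ.symm hγ0 hτ k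
  have hexp : 2 * k * Real.exp (a * k) / γ ≤ δ / 2 := by
    refine le_trans ?_ hγ2
    have he : Real.exp (a * k) ≤ γ / γ ^ δ := by
      rw [Real.rpow_def_of_pos hγ0]
      nth_rewrite 1 [← Real.exp_log hγ0]
      rw [← Real.exp_sub]
      gcongr
      rw [le_div_iff₀ ha] at hkle
      nlinarith
    have hpos : 0 < γ ^ δ := Real.rpow_pos_of_pos hγ0 δ
    calc 2 * k * Real.exp (a * k) / γ ≤ 2 * ((1 - δ) * Real.log γ / a) * (γ / γ ^ δ) / γ := by
          gcongr
      _ = _ := by field_simp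
  have hbr : ρ ^ k + ENNReal.ofReal (2 * k * Real.exp (a * k) / γ) ≤ ENNReal.ofReal δ := by
    calc _ ≤ ENNReal.ofReal (δ / 2) + ENNReal.ofReal (δ / 2) := by gcongr
      _ = _ := by rw [← ENNReal.ofReal_add (by linarith) (by linarith)]; congr 1; ring
  have hfin : ENNReal.ofReal (k + 1) ≤ WADD Q P τ + ENNReal.ofReal ((k + 1) * δ) := by
    rw [ENNReal.ofReal_mul (by positivity), ENNReal.ofReal_add (by positivity) zero_le_one,
      ENNReal.ofReal_natCast, ENNReal.ofReal_one]
    exact hmain.trans (by gcongr)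
  have hsub := tsub_le_iff_right.2 hfin
  rw [← ENNReal.ofReal_sub _ (by positivity)] at hsub
  refine le_trans (ENNReal.ofReal_le_ofReal ?_) hsub
  have h3 : (1 - δ) * ((1 - δ) * Real.log γ / a) ≤ (1 - δ) * (k + 1) :=
    mul_le_mul_of_nonneg_left hklt.le (by linarith)
  have h4 : c * Real.log γ ≤ (1 - δ) * ((1 - δ) * Real.log γ / a) := by
    rw [mul_div_assoc', le_div_iff₀ ha]
    nlinarith
  linarith

end DRCuSum

namespace DRCuSum

/-! ### Semi-discrete optimal transport -/

/-- `log ∑_j exp (u_j - a_j)`. -/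
noncomputable def logSumExp {n : ℕ} (a u : Fin n → ℝ) : ℝ :=
  Real.log (∑ j, Real.exp (u j - a j))

section LogSumExp

variable {n : ℕ} [NeZero n]

theorem sum_exp_pos (v : Fin n → ℝ) : 0 < ∑ j, Real.exp (v j) :=
  Finset.sum_pos (fun _ _ => Real.exp_pos _) Finset.univ_nonempty

theorem sub_le_logSumExp (a u : Fin n → ℝ) (j : Fin n) : u j - a j ≤ logSumExp a u := by
  rw [logSumExp, Real.le_log_iff_exp_le (sum_exp_pos _)]
  exact Finset.single_le_sum (f := fun j => Real.exp (u j - a j))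
    (fun _ _ => (Real.exp_pos _).le) (Finset.mem_univ j)

theorem logSumExp_le_add (a u v : Fin n → ℝ) {t : ℝ} (h : ∀ j, v j ≤ u j + t) :
    logSumExp a v ≤ logSumExp a u + t := by
  rw [logSumExp, Real.log_le_iff_le_exp (sum_exp_pos _), Real.exp_add, logSumExp,
    Real.exp_log (sum_exp_pos _), Finset.sum_mul]
  refine Finset.sum_le_sum fun j _ => ?_
  rw [← Real.exp_add, Real.exp_le_exp]
  linarith [h j]

theorem logSumExp_le {a : Fin n → ℝ} (ha : ∀ j, 0 ≤ a j) (u : Fin n → ℝ) {t : ℝ}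
    (h : ∀ j, u j ≤ t) : logSumExp a u ≤ Real.log n + t := by
  have hn : (0 : ℝ) < n := by exact_mod_cast NeZero.pos n
  rw [logSumExp, Real.log_le_iff_le_exp (sum_exp_pos _), Real.exp_add, Real.exp_log hn]
  calc ∑ j, Real.exp (u j - a j) ≤ ∑ _j : Fin n, Real.exp t :=
        Finset.sum_le_sum fun j _ => Real.exp_le_exp.2 (by linarith [h j, ha j])
    _ = _ := by simp

/-- The sum changes by an exact factor, and $\log(1+y)\le y$. The coefficient is the softmax weight,
so stationarity can be read off without differentiating under the integral. -/
theorem logSumExp_update_le (a u : Fin n → ℝ) (i : Fin n) (t : ℝ) :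
    logSumExp a (Function.update u i (u i + t)) ≤
      logSumExp a u + Real.exp (u i - a i - logSumExp a u) * (Real.exp t - 1) := by
  have hS := sum_exp_pos fun j => u j - a j
  have hsum : ∑ j, Real.exp (Function.update u i (u i + t) j - a j) =
      (∑ j, Real.exp (u j - a j)) *
        (1 + Real.exp (u i - a i - logSumExp a u) * (Real.exp t - 1)) := by
    rw [Real.exp_sub (u i - a i), logSumExp, Real.exp_log hS, mul_add, mul_one, ← mul_assoc,
      mul_div_cancel₀ _ hS.ne', ← Finset.add_sum_erase _ _ (Finset.mem_univ i),
      ← Finset.add_sum_erase _ (fun j => Real.exp (u j - a j)) (Finset.mem_univ i)]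
    have : ∑ j ∈ Finset.univ.erase i, Real.exp (Function.update u i (u i + t) j - a j) =
        ∑ j ∈ Finset.univ.erase i, Real.exp (u j - a j) :=
      Finset.sum_congr rfl fun j hj => by
        rw [Function.update_of_ne (Finset.ne_of_mem_erase hj)]
    rw [this, Function.update_self, show u i + t - a i = (u i - a i) + t by ring, Real.exp_add]
    ring
  have hpos : 0 < 1 + Real.exp (u i - a i - logSumExp a u) * (Real.exp t - 1) := by
    have h1 := sum_exp_pos fun j => Function.update u i (u i + t) j - a j
    rw [hsum] at h1
    exact (mul_pos_iff_of_pos_left hS).1 h1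
  rw [logSumExp, hsum, Real.log_mul hS.ne' hpos.ne', ← logSumExp]
  linarith [Real.log_le_sub_one_of_pos hpos]

end LogSumExp

variable {X : Type*} [MeasurableSpace X]

/-- Entropic regularization of the semi-discrete transport problem. -/
theorem exists_softmax_transport {n : ℕ} (hn : 1 ≤ n) (P : Measure X) [IsProbabilityMeasure P]
    {c : Fin n → X → ℝ} (hcm : ∀ j, Measurable (c j)) (hc0 : ∀ j x, 0 ≤ c j x)
    (hci : ∀ j, Integrable (c j) P) {R : ℝ}
    (hR : ∀ u : Fin n → ℝ, 1 / (n : ℝ) * ∑ j, u j + ∫ x, ⨅ j, (c j x - u j) ∂P ≤ R) :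
    ∃ w : Fin n → X → ℝ, (∀ j, Measurable (w j)) ∧ (∀ j x, 0 ≤ w j x) ∧
      (∀ x, ∑ j, w j x = 1) ∧ (∀ j, ∫ x, w j x ∂P = 1 / (n : ℝ)) ∧
      (∀ j, Integrable (fun x => w j x * c j x) P) ∧
      ∑ j, ∫ x, w j x * c j x ∂P ≤ R + Real.log n := by
  have : NeZero n := ⟨by omega⟩
  have hn0 : (0 : ℝ) < n := by exact_mod_cast hn
  set L : (Fin n → ℝ) → X → ℝ := fun u x => logSumExp (fun j => c j x) u with hL
  have hLm : ∀ u, Measurable (L u) := fun u =>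
    Real.measurable_log.comp (Finset.measurable_sum _ fun j _ =>
      Real.measurable_exp.comp (measurable_const.sub (hcm j)))
  have hLi : ∀ u, Integrable (L u) P := by
    intro u
    refine Integrable.mono' (g := fun x => Real.log n + ‖u‖ + (‖u‖ + c 0 x))
      ((integrable_const _).add ((integrable_const _).add (hci 0))) (hLm u).aestronglyMeasurable
      (Eventually.of_forall fun x => ?_)
    have h1 := logSumExp_le (fun j => hc0 j x) u
      (fun j => (le_abs_self _).trans (norm_le_pi_norm u j))
    have h2 := sub_le_logSumExp (fun j => c j x) u 0
    have h3 := neg_le_of_abs_le (norm_le_pi_norm u 0)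
    have h4 : 0 ≤ Real.log n := Real.log_natCast_nonneg n
    have h5 := norm_nonneg u
    have h6 := hc0 0 x
    rw [Real.norm_eq_abs, abs_le]
    constructor <;> simp only [hL] <;> linarith
  set F : (Fin n → ℝ) → ℝ := fun u => 1 / (n : ℝ) * ∑ j, u j - ∫ x, L u x ∂P with hF
  have hLint : ∀ u v (t : ℝ), (∀ j, v j ≤ u j + t) → ∫ x, L v x ∂P ≤ ∫ x, L u x ∂P + t := by
    intro u v t h
    calc _ ≤ ∫ x, (L u x + t) ∂P := integral_mono (hLi v) ((hLi u).add (integrable_const t))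
          fun x => logSumExp_le_add _ u v h
      _ = _ := by rw [integral_add (hLi u) (integrable_const t)]; simp
  have hFcont : Continuous F := by
    refine (continuous_const.mul (by fun_prop)).sub ?_
    refine (LipschitzWith.of_dist_le_mul (K := 1) fun u v => ?_).continuous
    have hd : ∀ u v : Fin n → ℝ, ∀ j, v j ≤ u j + dist u v := fun u v j => by
      have := dist_le_pi_dist v u j
      rw [Real.dist_eq, dist_comm v u] at this
      linarith [le_abs_self (v j - u j)]
    have h1 := hLint u v _ (hd u v)
    have h2 := hLint v u _ (hd v u)
    rw [dist_comm v u] at h2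
    rw [Real.dist_eq, abs_le, NNReal.coe_one]
    constructor <;> linarith
  set C := ∑ j, ∫ x, c j x ∂P with hC
  have hcC : ∀ j, ∫ x, c j x ∂P ≤ C := fun j =>
    Finset.single_le_sum (f := fun j => ∫ x, c j x ∂P)
      (fun j _ => integral_nonneg (hc0 j)) (Finset.mem_univ j)
  have hFle : ∀ u j, F u ≤ 1 / (n : ℝ) * ∑ j, u j - u j + C := by
    intro u j
    have h1 : ∫ x, (u j - c j x) ∂P ≤ ∫ x, L u x ∂P :=
      integral_mono ((integrable_const _).sub (hci j)) (hLi u) fun x => sub_le_logSumExp (fun j => c j x) u j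
    rw [integral_sub (integrable_const _) (hci j)] at h1
    simp only [integral_const, probReal_univ, smul_eq_mul, one_mul] at h1
    simp only [hF]
    linarith [hcC j]
  have hFshift : ∀ u (t : ℝ), F (fun j => u j - t) = F u := by
    intro u t
    have h1 := hLint u (fun j => u j - t) (-t) (fun j => by linarith)
    have h2 := hLint (fun j => u j - t) u t (fun j => by simp)
    have h3 : 1 / (n : ℝ) * ∑ j, (u j - t) = 1 / (n : ℝ) * ∑ j, u j - t := by
      rw [Finset.sum_sub_distrib]
      simp only [Finset.sum_const, Finset.card_univ, Fintype.card_fin, nsmul_eq_mul]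
      field_simp
    simp only [hF, h3]
    linarith
  -- After a shift making the largest coordinate `0`, a coordinate below `-B` forces `F` below `-B /
  -- n + C = F 0`. The search for a maximizer is thus confined to a compact box.
  set B := n * (C - F 0) with hB
  have hB0 : 0 ≤ B := by
    have := hFle 0 0
    simp only [Pi.zero_apply, Finset.sum_const_zero, mul_zero, sub_zero, zero_add] at this
    exact mul_nonneg hn0.le (by linarith)
  obtain ⟨u, hu, humax⟩ := (isCompact_Icc (a := fun _ : Fin n => -B) (b := 0)).exists_isMaxOn
    ⟨0, fun _ => by simpa using hB0, le_rfl⟩ hFcont.continuousOn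
  have hglob : ∀ v, F v ≤ F u := by
    intro v
    obtain ⟨j₀, hj₀⟩ := Finite.exists_max v
    rw [← hFshift v (v j₀)]
    by_cases hmem : (fun j => v j - v j₀) ∈ Set.Icc (fun _ : Fin n => -B) 0
    · exact humax hmem
    · have hle : ∀ j, v j - v j₀ ≤ 0 := fun j => by linarith [hj₀ j]
      obtain ⟨j, hj⟩ : ∃ j, v j - v j₀ < -B := by
        by_contra hcon
        push Not at hcon
        exact hmem ⟨hcon, hle⟩
      have h1 := hFle (fun j => v j - v j₀) j₀
      have h2 : ∑ j, (v j - v j₀) ≤ v j - v j₀ := by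
        rw [← Finset.add_sum_erase _ _ (Finset.mem_univ j)]
        linarith [Finset.sum_nonpos (s := Finset.univ.erase j) fun i _ => hle i]
      have h3 : 1 / (n : ℝ) * ∑ j, (v j - v j₀) ≤ 1 / (n : ℝ) * (-B) :=
        mul_le_mul_of_nonneg_left (by linarith) (by positivity)
      have h4 : 1 / (n : ℝ) * (-B) = F 0 - C := by rw [hB]; field_simp; ring
      have h5 : F 0 ≤ F u := humax (a := 0) ⟨fun _ => by simpa using hB0, le_rfl⟩
      simp only [sub_self, sub_zero] at h1
      linarith
  set w : Fin n → X → ℝ := fun j x => Real.exp (u j - c j x - L u x) with hw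
  have hwm : ∀ j, Measurable (w j) := fun j =>
    Real.measurable_exp.comp ((measurable_const.sub (hcm j)).sub (hLm u))
  have hw0 : ∀ j x, 0 < w j x := fun j x => Real.exp_pos _
  have hw1 : ∀ x, ∑ j, w j x = 1 := by
    intro x
    have hS := sum_exp_pos fun j => u j - c j x
    have h : ∀ j, w j x = Real.exp (u j - c j x) / ∑ j, Real.exp (u j - c j x) := fun j => by
      simp only [hw, hL, logSumExp]
      rw [Real.exp_sub (u j - c j x), Real.exp_log hS]
    simp only [h]
    rw [← Finset.sum_div, div_self hS.ne']
  have hwle : ∀ j x, w j x ≤ 1 := fun j x => by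
    rw [← hw1 x]
    exact Finset.single_le_sum (f := fun j => w j x) (fun j _ => (hw0 j x).le) (Finset.mem_univ j)
  have hwi : ∀ j, Integrable (w j) P := fun j =>
    Integrable.of_bound (C := 1) (hwm j).aestronglyMeasurable (Eventually.of_forall fun x => by
      rw [Real.norm_of_nonneg (hw0 j x).le]; exact hwle j x)
  have hwn : ∀ j, ∫ x, w j x ∂P = 1 / (n : ℝ) := by
    intro i
    set p := ∫ x, w i x ∂P with hp
    -- Maximality of `u` against changes of one coordinate; the right side vanishes at `t = 0`, so
    -- its derivative `p - 1 / n` is zero there. These stationarity conditions are the second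
    -- marginal constraint.
    have hmin : ∀ t : ℝ, 0 ≤ p * (Real.exp t - 1) - 1 / (n : ℝ) * t := by
      intro t
      have h1 := hglob (Function.update u i (u i + t))
      have h2 : ∫ x, L (Function.update u i (u i + t)) x ∂P ≤
          ∫ x, L u x ∂P + p * (Real.exp t - 1) := by
        calc _ ≤ ∫ x, (L u x + w i x * (Real.exp t - 1)) ∂P :=
              integral_mono (hLi _) ((hLi u).add ((hwi i).mul_const _))
                fun x => logSumExp_update_le _ u i t
          _ = _ := by
              rw [integral_add (hLi u) ((hwi i).mul_const _), integral_mul_const]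
      have h3 : ∑ j, Function.update u i (u i + t) j = ∑ j, u j + t := by
        rw [Finset.sum_update_of_mem (Finset.mem_univ i),
          ← Finset.add_sum_erase _ u (Finset.mem_univ i), Finset.sdiff_singleton_eq_erase]
        ring
      simp only [hF, h3] at h1
      rw [mul_add] at h1
      linarith
    have hder : HasDerivAt (fun t : ℝ => p * (Real.exp t - 1) - 1 / (n : ℝ) * t)
        (p * Real.exp 0 - 1 / (n : ℝ) * 1) 0 :=
      (((Real.hasDerivAt_exp 0).sub_const 1).const_mul p).sub ((hasDerivAt_id 0).const_mul _)
    have hlm : IsLocalMin (fun t : ℝ => p * (Real.exp t - 1) - 1 / (n : ℝ) * t) 0 :=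
      Eventually.of_forall fun t => by simpa using hmin t
    have := hlm.hasDerivAt_eq_zero hder
    rw [Real.exp_zero] at this
    linarith
  have hwci : ∀ j, Integrable (fun x => w j x * c j x) P := fun j =>
    Integrable.mono' (hci j) ((hwm j).mul (hcm j)).aestronglyMeasurable
      (Eventually.of_forall fun x => by
        rw [Real.norm_of_nonneg (mul_nonneg (hw0 j x).le (hc0 j x))]
        exact mul_le_of_le_one_left (hc0 j x) (hwle j x))
  refine ⟨w, hwm, fun j x => (hw0 j x).le, hw1, hwn, hwci, ?_⟩
  have hpt : ∀ x, ∑ j, w j x * c j x ≤ ∑ j, w j x * u j - L u x + Real.log n := by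
    intro x
    have hterm : ∀ j, w j x * c j x ≤
        w j x * u j - w j x * L u x + (w j x * Real.log n + 1 / (n : ℝ) - w j x) := by
      intro j
      have hlog : Real.log (w j x) = u j - c j x - L u x := Real.log_exp _
      -- Gibbs' inequality against the uniform weights: the entropy of the softmax weights is at
      -- most `log n`.
      have h1 : Real.log (1 / (n * w j x)) ≤ 1 / (n * w j x) - 1 :=
        Real.log_le_sub_one_of_pos (by have := hw0 j x; positivity)
      rw [one_div, Real.log_inv, Real.log_mul hn0.ne' (hw0 j x).ne', hlog] at h1
      have h2 := mul_le_mul_of_nonneg_left h1 (hw0 j x).le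
      have h3 : w j x * ((↑n * w j x)⁻¹ - 1) = 1 / (n : ℝ) - w j x := by
        have := (hw0 j x).ne'
        field_simp
      rw [h3] at h2
      linarith
    calc _ ≤ ∑ j, (w j x * u j - w j x * L u x + (w j x * Real.log n + 1 / (n : ℝ) - w j x)) :=
          Finset.sum_le_sum fun j _ => hterm j
      _ = _ := by
          simp only [Finset.sum_add_distrib, Finset.sum_sub_distrib, ← Finset.sum_mul, hw1]
          simp only [Finset.sum_const, Finset.card_univ, Fintype.card_fin, nsmul_eq_mul]
          field_simp
          ring
  have hFR : F u ≤ R := by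
    refine le_trans ?_ (hR u)
    have hInf : ∀ x, -L u x ≤ ⨅ j, (c j x - u j) := fun x =>
      le_ciInf fun j => by linarith [sub_le_logSumExp (fun j => c j x) u j]
    have hInf0 : ∀ x, (⨅ j, (c j x - u j)) ≤ c 0 x - u 0 := fun x =>
      ciInf_le (Set.finite_range _).bddBelow 0
    have hInfi : Integrable (fun x => ⨅ j, (c j x - u j)) P :=
      integrable_of_le_of_le (Measurable.iInf fun j => (hcm j).sub_const _).aestronglyMeasurable
        (Eventually.of_forall hInf) (Eventually.of_forall hInf0) (hLi u).neg
        ((hci 0).sub (integrable_const _))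
    have := integral_mono (hLi u).neg hInfi hInf
    simp only [Pi.neg_apply, integral_neg] at this
    simp only [hF]
    linarith
  rw [← integral_finsetSum _ fun j _ => hwci j]
  have hi1 : Integrable (fun x => ∑ j, w j x * u j) P :=
    integrable_finsetSum _ fun j _ => (hwi j).mul_const _
  calc _ ≤ ∫ x, (∑ j, w j x * u j - L u x + Real.log n) ∂P :=
        integral_mono (integrable_finsetSum _ fun j _ => hwci j)
          ((hi1.sub (hLi u)).add (integrable_const _)) hpt
    _ = F u + Real.log n := by
        rw [integral_add (by exact hi1.sub (hLi u)) (integrable_const _),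
          integral_sub hi1 (hLi u), integral_finsetSum _ fun j _ => (hwi j).mul_const _]
        simp only [integral_mul_const, hwn, ← Finset.mul_sum, integral_const, probReal_univ,
          smul_eq_mul, one_mul, hF]
    _ ≤ _ := by linarith

/-- Scaling the cost by `ε⁻¹` shrinks the entropic error to `ε * log n`. As the Wasserstein distance
is an infimum, no optimal plan is needed. -/
theorem exists_transport_cost_le {n : ℕ} (hn : 1 ≤ n) (P : Measure X) [IsProbabilityMeasure P]
    {c : Fin n → X → ℝ} (hcm : ∀ j, Measurable (c j)) (hc0 : ∀ j x, 0 ≤ c j x)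
    (hci : ∀ j, Integrable (c j) P) {R : ℝ}
    (hR : ∀ u : Fin n → ℝ, 1 / (n : ℝ) * ∑ j, u j + ∫ x, ⨅ j, (c j x - u j) ∂P ≤ R)
    {ε : ℝ} (hε : 0 < ε) :
    ∃ w : Fin n → X → ℝ, (∀ j, Measurable (w j)) ∧ (∀ j x, 0 ≤ w j x) ∧
      (∀ x, ∑ j, w j x = 1) ∧ (∀ j, ∫ x, w j x ∂P = 1 / (n : ℝ)) ∧
      (∀ j, Integrable (fun x => w j x * c j x) P) ∧
      ∑ j, ∫ x, w j x * c j x ∂P ≤ R + ε * Real.log n := by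
  have : Nonempty (Fin n) := ⟨⟨0, hn⟩⟩
  obtain ⟨w, h1, h2, h3, h4, h5, h6⟩ := exists_softmax_transport hn P
    (c := fun j x => ε⁻¹ * c j x) (fun j => (hcm j).const_mul _)
    (fun j x => mul_nonneg (inv_pos.2 hε).le (hc0 j x)) (fun j => (hci j).const_mul _)
    (R := ε⁻¹ * R) (fun u => by
      have h := mul_le_mul_of_nonneg_left (hR fun j => ε * u j) (inv_pos.2 hε).le
      have hx : ∀ x, (⨅ j, (ε⁻¹ * c j x - u j)) = ε⁻¹ * ⨅ j, (c j x - ε * u j) := by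
        intro x
        rw [Real.mul_iInf_of_nonneg (inv_pos.2 hε).le]
        congr 1; ext j
        field_simp
      simp_rw [hx]
      rw [integral_const_mul]
      rw [← Finset.mul_sum, mul_add] at h
      have e : 1 / (n : ℝ) * ∑ j, u j = ε⁻¹ * (1 / (n : ℝ) * (ε * ∑ j, u j)) := by field_simp
      rw [e]
      exact h)
  have h7 : ∀ j x, w j x * (ε⁻¹ * c j x) = ε⁻¹ * (w j x * c j x) := fun j x => by ring
  simp only [h7, integral_const_mul, ← Finset.mul_sum] at h6
  refine ⟨w, h1, h2, h3, h4, fun j => ?_, ?_⟩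
  · have := (h5 j).const_mul ε
    refine this.congr (Eventually.of_forall fun x => ?_)
    simp only
    field_simp
  · have := mul_le_mul_of_nonneg_left h6 hε.le
    rw [mul_add, ← mul_assoc, ← mul_assoc, mul_inv_cancel₀ hε.ne', one_mul, one_mul] at this
    exact this

end DRCuSum

/-! ### Means from exponential moments, and geometry of the tilting cost -/

namespace DRCuSum

/-- As $t\downarrow0$ the quotients $(1-e^{-tY})/t$ converge to $Y$ with means at most $R$. Fatou's
lemma then yields the bound on the mean together with integrability, which cannot be assumed. -/
theorem integrable_and_integral_le_of_forall_exp {X : Type*} [MeasurableSpace X] (P : Measure X)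
    [IsProbabilityMeasure P] {Y : X → ℝ} (hY : Measurable Y) {B R : ℝ} (hB : 0 ≤ B)
    (hYB : ∀ x, -B ≤ Y x)
    (h : ∀ t : ℝ, 0 < t → t ≤ 1 → 1 - t * R ≤ ∫ x, Real.exp (-(t * Y x)) ∂P) :
    Integrable Y P ∧ ∫ x, Y x ∂P ≤ R := by
  -- A lower bound `-K` for all quotients with `t ≤ 1`, from $e^{tB}-1\le tBe^{tB}$; adding `K`
  -- makes Fatou's lemma applicable.
  set K := B * Real.exp B with hK
  have hBK : B ≤ K := le_mul_of_one_le_right hB (Real.one_le_exp hB)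
  set t : ℕ → ℝ := fun k => 1 / ((k : ℝ) + 1) with ht
  have ht0 : ∀ k, 0 < t k := fun k => by positivity
  have ht1 : ∀ k, t k ≤ 1 := fun k => by
    rw [ht, div_le_one (by positivity)]; linarith [(Nat.cast_nonneg k : (0 : ℝ) ≤ k)]
  set f : ℕ → X → ℝ := fun k x => (t k)⁻¹ * (1 - Real.exp (-(t k * Y x))) + K with hf
  have hei : ∀ k, Integrable (fun x => Real.exp (-(t k * Y x))) P := fun k => by
    refine Integrable.of_bound (C := Real.exp (t k * B)) (by fun_prop)
      (Eventually.of_forall fun x => ?_)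
    rw [Real.norm_of_nonneg (Real.exp_pos _).le]
    gcongr
    nlinarith [hYB x, ht0 k]
  have hf0 : ∀ k x, 0 ≤ f k x := by
    intro k x
    have h1 : Real.exp (-(t k * Y x)) ≤ Real.exp (t k * B) := by
      gcongr; nlinarith [hYB x, ht0 k]
    have h2 : Real.exp (t k * B) - 1 ≤ t k * B * Real.exp (t k * B) := by
      have h3 := Real.add_one_le_exp (-(t k * B))
      have h4 := mul_le_mul_of_nonneg_right h3 (Real.exp_pos (t k * B)).le
      rw [← Real.exp_add, neg_add_cancel, Real.exp_zero] at h4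
      linarith
    have h3 : t k * B * Real.exp (t k * B) ≤ t k * K := by
      rw [hK, mul_assoc]
      have : t k * B ≤ B := mul_le_of_le_one_left hB (ht1 k)
      have := (ht0 k).le
      gcongr
    have h4 : -(t k * K) ≤ 1 - Real.exp (-(t k * Y x)) := by linarith
    have h5 := mul_le_mul_of_nonneg_left h4 (inv_pos.2 (ht0 k)).le
    rw [mul_neg, ← mul_assoc, inv_mul_cancel₀ (ht0 k).ne', one_mul] at h5
    simp only [hf]; linarith
  have hfi : ∀ k, Integrable (f k) P := fun k =>
    (((integrable_const _).sub (hei k)).const_mul _).add (integrable_const _)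
  have hfint : ∀ k, ∫ x, f k x ∂P ≤ R + K := by
    intro k
    simp only [hf]
    rw [integral_add (by exact ((integrable_const _).sub (hei k)).const_mul _) (integrable_const _),
      integral_const_mul, integral_sub (integrable_const _) (hei k)]
    simp only [integral_const, probReal_univ, smul_eq_mul, one_mul]
    have h1 := mul_le_mul_of_nonneg_left (h (t k) (ht0 k) (ht1 k)) (inv_pos.2 (ht0 k)).le
    have h2 : (t k)⁻¹ * (1 - t k * R) = (t k)⁻¹ - R := by
      have := (ht0 k).ne'; field_simp
    rw [h2] at h1
    linarith
  have htlim : Tendsto t atTop (𝓝[>] 0) :=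
    tendsto_nhdsWithin_iff.2 ⟨tendsto_one_div_add_atTop_nhds_zero_nat,
      Eventually.of_forall ht0⟩
  have hflim : ∀ x, Tendsto (fun k => f k x) atTop (𝓝 (Y x + K)) := by
    intro x
    have hder : HasDerivAt (fun s : ℝ => 1 - Real.exp (-(s * Y x))) (Y x) 0 := by
      have h1 : HasDerivAt (fun s : ℝ => -(s * Y x)) (-(1 * Y x)) 0 :=
        ((hasDerivAt_id (0 : ℝ)).mul_const (Y x)).neg
      have h2 := (h1.exp).const_sub 1
      simpa using h2
    have h3 := (hder.tendsto_slope_zero_right.comp htlim).add_const K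
    refine h3.congr fun k => ?_
    simp [hf]
  have hfatou : ∫⁻ x, ENNReal.ofReal (Y x + K) ∂P ≤ ENNReal.ofReal (R + K) := by
    calc ∫⁻ x, ENNReal.ofReal (Y x + K) ∂P
        = ∫⁻ x, liminf (fun k => ENNReal.ofReal (f k x)) atTop ∂P := by
          refine lintegral_congr fun x => ?_
          exact ((ENNReal.continuous_ofReal.tendsto _).comp (hflim x)).liminf_eq.symm
      _ ≤ liminf (fun k => ∫⁻ x, ENNReal.ofReal (f k x) ∂P) atTop :=
          lintegral_liminf_le fun k => by
            simp only [hf]; fun_prop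
      _ ≤ liminf (fun _ : ℕ => ENNReal.ofReal (R + K)) atTop := by
          refine liminf_le_liminf (Eventually.of_forall fun k => ?_)
          rw [← ofReal_integral_eq_lintegral_ofReal (hfi k) (Eventually.of_forall (hf0 k))]
          exact ENNReal.ofReal_le_ofReal (hfint k)
      _ = _ := by simp
  have hnn : ∀ x, 0 ≤ Y x + K := fun x => by linarith [hYB x]
  have hYKi : Integrable (fun x => Y x + K) P := by
    refine ⟨by fun_prop, ?_⟩
    rw [hasFiniteIntegral_iff_ofReal (Eventually.of_forall hnn)]
    exact hfatou.trans_lt ENNReal.ofReal_lt_top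
  have hYi : Integrable Y P := by
    refine (hYKi.sub (integrable_const K)).congr (Eventually.of_forall fun x => ?_)
    simp
  refine ⟨hYi, ?_⟩
  rw [← ofReal_integral_eq_lintegral_ofReal hYKi (Eventually.of_forall hnn),
    integral_add hYi (integrable_const K)] at hfatou
  simp only [integral_const, probReal_univ, smul_eq_mul, one_mul] at hfatou
  have hRK : 0 ≤ R + K := (integral_nonneg (hf0 0)).trans (hfint 0)
  have := (ENNReal.ofReal_le_ofReal_iff hRK).1 hfatou
  linarith

variable {X : Type*} [MetricSpace X]

/-! ### The tilting cost -/

section TiltCost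

variable {n : ℕ} (s : ℝ) (ω : Fin n → X)

theorem tiltCost_le (lam : ℝ) (u : Fin n → ℝ) (x : X) (j : Fin n) :
    tiltCost s ω lam u x ≤ lam * dist x (ω j) ^ s - u j :=
  ciInf_le (Set.finite_range _).bddBelow j

theorem exists_tiltCost_eq [NeZero n] (lam : ℝ) (u : Fin n → ℝ) (x : X) :
    ∃ j, tiltCost s ω lam u x = lam * dist x (ω j) ^ s - u j := by
  obtain ⟨j, hj⟩ := exists_eq_ciInf_of_finite (f := fun j => lam * dist x (ω j) ^ s - u j)
  exact ⟨j, hj.symm⟩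

theorem neg_norm_le_tiltCost [NeZero n] {lam : ℝ} (hlam : 0 ≤ lam) (u : Fin n → ℝ) (x : X) :
    -‖u‖ ≤ tiltCost s ω lam u x := by
  obtain ⟨j, hj⟩ := exists_tiltCost_eq s ω lam u x
  rw [hj]
  have h1 := (le_abs_self _).trans (norm_le_pi_norm u j)
  have h2 : 0 ≤ lam * dist x (ω j) ^ s := mul_nonneg hlam (Real.rpow_nonneg dist_nonneg s)
  linarith

/-- Superadditivity of minima replaces concavity of the dual objective when the dual variables are
moved. -/
theorem tiltCost_add_le [NeZero n] (lam lam' : ℝ) (u u' : Fin n → ℝ) (x : X) :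
    tiltCost s ω lam u x + tiltCost s ω lam' u' x ≤ tiltCost s ω (lam + lam') (u + u') x := by
  obtain ⟨j, hj⟩ := exists_tiltCost_eq s ω (lam + lam') (u + u') x
  rw [hj, Pi.add_apply]
  linarith [tiltCost_le s ω lam u x j, tiltCost_le s ω lam' u' x j]

theorem tiltCost_smul {t : ℝ} (ht : 0 ≤ t) (lam : ℝ) (u : Fin n → ℝ) (x : X) :
    tiltCost s ω (t * lam) (t • u) x = t * tiltCost s ω lam u x := by
  rw [tiltCost, tiltCost, Real.mul_iInf_of_nonneg ht]
  congr 1; ext j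
  simp only [Pi.smul_apply, smul_eq_mul]
  ring

end TiltCost

theorem edist_rpow_eq_ofReal {s : ℝ} (hs : 0 ≤ s) (x y : X) :
    edist x y ^ s = ENNReal.ofReal (dist x y ^ s) := by
  rw [edist_dist, ENNReal.ofReal_rpow_of_nonneg dist_nonneg hs]

variable [MeasurableSpace X]

theorem measurable_dist_left (hdist : Measurable fun z : X × X => dist z.1 z.2) (y : X) :
    Measurable fun x => dist x y :=
  hdist.comp (measurable_id.prodMk measurable_const)

theorem measurable_tiltCost (hdist : Measurable fun z : X × X => dist z.1 z.2) {n : ℕ} (s : ℝ)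
    (ω : Fin n → X) (lam : ℝ) (u : Fin n → ℝ) : Measurable (tiltCost s ω lam u) :=
  Measurable.iInf fun j =>
    (((measurable_dist_left hdist (ω j)).pow_const s).const_mul lam).sub_const (u j)

/-- The σ-algebra need not be Borel for the metric, but joint measurability of the distance makes
points measurable, as needed to work with the atoms of the empirical measure. -/
theorem measurableSingletonClass (hdist : Measurable fun z : X × X => dist z.1 z.2) :
    MeasurableSingletonClass X := by
  refine ⟨fun y => ?_⟩
  have : ({y} : Set X) = (fun x => dist x y) ⁻¹' {0} := by ext x; simp
  rw [this]
  exact measurable_dist_left hdist y (measurableSet_singleton 0)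

theorem integrable_exp_neg_tiltCost (hdist : Measurable fun z : X × X => dist z.1 z.2)
    (Q : Measure X) [IsProbabilityMeasure Q] {n : ℕ} [NeZero n] (s : ℝ) (ω : Fin n → X) {lam : ℝ}
    (hlam : 0 ≤ lam) (u : Fin n → ℝ) :
    Integrable (fun x => Real.exp (-tiltCost s ω lam u x)) Q := by
  have hm := measurable_tiltCost hdist s ω lam u
  refine Integrable.of_bound (C := Real.exp ‖u‖) (by fun_prop) (Eventually.of_forall fun x => ?_)
  rw [Real.norm_of_nonneg (Real.exp_pos _).le]
  gcongr
  linarith [neg_norm_le_tiltCost s ω hlam u x]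

theorem tiltMass_pos (hdist : Measurable fun z : X × X => dist z.1 z.2)
    (Q : Measure X) [IsProbabilityMeasure Q] {n : ℕ} [NeZero n] (s : ℝ) (ω : Fin n → X) {lam : ℝ}
    (hlam : 0 ≤ lam) (u : Fin n → ℝ) : 0 < tiltMass Q s ω lam u :=
  integral_exp_pos (integrable_exp_neg_tiltCost hdist Q s ω hlam u)

theorem measurable_logLR (hdist : Measurable fun z : X × X => dist z.1 z.2) (Q : Measure X)
    {n : ℕ} (s : ℝ) (ω : Fin n → X) (lam : ℝ) (u : Fin n → ℝ) :
    Measurable (logLR Q s ω lam u) :=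
  (measurable_tiltCost hdist s ω lam u).neg.sub_const _

theorem logLR_le (Q : Measure X) {n : ℕ} [NeZero n] (s : ℝ) (ω : Fin n → X) {lam : ℝ}
    (hlam : 0 ≤ lam) (u : Fin n → ℝ) (x : X) :
    logLR Q s ω lam u x ≤ ‖u‖ - Real.log (tiltMass Q s ω lam u) := by
  rw [logLR]
  linarith [neg_norm_le_tiltCost s ω hlam u x]

theorem tilted_eq_tilted (hdist : Measurable fun z : X × X => dist z.1 z.2)
    (Q : Measure X) [IsProbabilityMeasure Q] {n : ℕ} [NeZero n] (s : ℝ) (ω : Fin n → X) {lam : ℝ}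
    (hlam : 0 ≤ lam) (u : Fin n → ℝ) :
    tilted Q s ω lam u = Q.tilted fun x => -tiltCost s ω lam u x := by
  rw [tilted, Measure.tilted]
  congr 1; ext x
  rw [logLR, Real.exp_sub, Real.exp_log (tiltMass_pos hdist Q s ω hlam u), tiltMass]

theorem isProbabilityMeasure_tilted_tiltCost (hdist : Measurable fun z : X × X => dist z.1 z.2)
    (Q : Measure X) [IsProbabilityMeasure Q] {n : ℕ} [NeZero n] (s : ℝ) (ω : Fin n → X) {lam : ℝ}
    (hlam : 0 ≤ lam) (u : Fin n → ℝ) : IsProbabilityMeasure (tilted Q s ω lam u) := by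
  rw [tilted_eq_tilted hdist Q s ω hlam u]
  exact isProbabilityMeasure_tilted (integrable_exp_neg_tiltCost hdist Q s ω hlam u)

/-! ### Wasserstein balls -/

/-- The strong half of Kantorovich duality for a finitely supported target: near-optimal softmax
weights define a coupling, and `ε` then tends to `0`. -/
theorem wasserstein_le_of_forall_dual (hdist : Measurable fun z : X × X => dist z.1 z.2)
    {n : ℕ} (hn : 1 ≤ n) {s r : ℝ} (hs : 1 ≤ s) (hr : 0 ≤ r) (ω : Fin n → X) (P : Measure X)
    [IsProbabilityMeasure P] (hInt : ∀ j, Integrable (fun x => dist x (ω j) ^ s) P)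
    (h : ∀ u : Fin n → ℝ, 1 / (n : ℝ) * ∑ j, u j + ∫ x, tiltCost s ω 1 u x ∂P ≤ r ^ s) :
    wasserstein s P (empirical ω) ≤ ENNReal.ofReal r := by
  have hs0 : 0 < s := by linarith
  have hdm := fun j => (measurable_dist_left hdist (ω j)).pow_const s
  have hnn : ∀ j x, 0 ≤ dist x (ω j) ^ s := fun j x => Real.rpow_nonneg dist_nonneg s
  rw [wasserstein, one_div, ENNReal.rpow_inv_le_iff hs0, ENNReal.ofReal_rpow_of_nonneg hr hs0.le]
  have key : ∀ ε : ℝ, 0 < ε →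
      (⨅ (Γ : Measure (X × X)) (_ : Γ.map Prod.fst = P ∧ Γ.map Prod.snd = empirical ω),
        ∫⁻ z, edist z.1 z.2 ^ s ∂Γ) ≤ ENNReal.ofReal (r ^ s + ε * Real.log n) := by
    intro ε hε
    obtain ⟨w, hwm, hw0, hw1, hwn, hwi, hwc⟩ := exists_transport_cost_le hn P
      (c := fun j x => dist x (ω j) ^ s) hdm hnn hInt (R := r ^ s)
      (fun u => by simpa [tiltCost] using h u) hε
    have hwm' : ∀ j, Measurable fun x => ENNReal.ofReal (w j x) := fun j => (hwm j).ennreal_ofReal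
    have hpair : ∀ j, Measurable fun x : X => (x, ω j) := fun j =>
      measurable_id.prodMk measurable_const
    have hsum1 : ∀ x, ∑ j, ENNReal.ofReal (w j x) = 1 := fun x => by
      rw [← ENNReal.ofReal_sum_of_nonneg fun j _ => hw0 j x, hw1, ENNReal.ofReal_one]
    -- The weight `w j x` is the fraction of the mass at `x` sent to `ω j`.
    set Γ : Measure (X × X) :=
      ∑ j, (P.withDensity fun x => ENNReal.ofReal (w j x)).map fun x => (x, ω j) with hΓ
    have hfst : Γ.map Prod.fst = P := by
      rw [hΓ, Measure.map_finset_sum measurable_fst.aemeasurable]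
      simp_rw [Measure.map_map measurable_fst (hpair _)]
      ext t ht
      simp only [Function.comp_def, Measure.map_id', Measure.coe_finsetSum, Finset.sum_apply,
        withDensity_apply _ ht]
      rw [← lintegral_finsetSum _ fun j _ => hwm' j]
      simp [hsum1]
    have hsnd : Γ.map Prod.snd = empirical ω := by
      rw [hΓ, Measure.map_finset_sum measurable_snd.aemeasurable]
      simp_rw [Measure.map_map measurable_snd (hpair _)]
      simp only [Function.comp_def, Measure.map_const, empirical, Finset.smul_sum]
      refine Finset.sum_congr rfl fun j _ => ?_
      congr 1
      rw [withDensity_apply _ MeasurableSet.univ, Measure.restrict_univ,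
        ← ofReal_integral_eq_lintegral_ofReal ?_ (Eventually.of_forall (hw0 j)), hwn, one_div,
        ENNReal.ofReal_inv_of_pos (by exact_mod_cast hn), ENNReal.ofReal_natCast]
      refine Integrable.of_bound (C := 1) (hwm j).aestronglyMeasurable
        (Eventually.of_forall fun x => ?_)
      rw [Real.norm_of_nonneg (hw0 j x), ← hw1 x]
      exact Finset.single_le_sum (f := fun j => w j x) (fun j _ => hw0 j x) (Finset.mem_univ j)
    refine (iInf₂_le Γ ⟨hfst, hsnd⟩).trans ?_
    simp_rw [edist_rpow_eq_ofReal hs0.le]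
    rw [hΓ, lintegral_finsetSum_measure]
    calc _ = ∑ j, ENNReal.ofReal (∫ x, w j x * dist x (ω j) ^ s ∂P) := by
          refine Finset.sum_congr rfl fun j _ => ?_
          rw [lintegral_map (hdist.pow_const s).ennreal_ofReal (hpair j),
            lintegral_withDensity_eq_lintegral_mul _ (hwm' j) (hdm j).ennreal_ofReal,
            ofReal_integral_eq_lintegral_ofReal (hwi j)
              (Eventually.of_forall fun x => mul_nonneg (hw0 j x) (hnn j x))]
          refine lintegral_congr fun x => ?_
          rw [Pi.mul_apply, ENNReal.ofReal_mul (hw0 j x)]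
      _ ≤ _ := by
          rw [← ENNReal.ofReal_sum_of_nonneg fun j _ =>
            integral_nonneg fun x => mul_nonneg (hw0 j x) (hnn j x)]
          exact ENNReal.ofReal_le_ofReal hwc
  have hlim : Tendsto (fun ε : ℝ => ENNReal.ofReal (r ^ s + ε * Real.log n)) (𝓝[>] 0)
      (𝓝 (ENNReal.ofReal (r ^ s))) := by
    have : Continuous fun ε : ℝ => ENNReal.ofReal (r ^ s + ε * Real.log n) :=
      ENNReal.continuous_ofReal.comp (by fun_prop)
    simpa using (this.tendsto 0).mono_left nhdsWithin_le_nhds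
  exact ge_of_tendsto hlim (eventually_nhdsWithin_of_forall fun ε hε => key ε hε)

theorem integrable_dist_rpow_of_mem_wassersteinBall
    (hdist : Measurable fun z : X × X => dist z.1 z.2) {n : ℕ} {s r : ℝ} (hs : 0 ≤ s)
    {ω : Fin n → X} {P : Measure X} (hP : P ∈ wassersteinBall s r ω) (y : X) :
    Integrable (fun x => dist x y ^ s) P := by
  refine ⟨((measurable_dist_left hdist y).pow_const s).aestronglyMeasurable, ?_⟩
  rw [hasFiniteIntegral_iff_ofReal (Eventually.of_forall fun x => Real.rpow_nonneg dist_nonneg s)]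
  simpa only [edist_rpow_eq_ofReal hs] using hP.2.1 y

theorem integrable_tiltCost (hdist : Measurable fun z : X × X => dist z.1 z.2) {n : ℕ} [NeZero n]
    {s : ℝ} (ω : Fin n → X) {P : Measure X} [IsProbabilityMeasure P]
    (hInt : ∀ j, Integrable (fun x => dist x (ω j) ^ s) P) {lam : ℝ} (hlam : 0 ≤ lam)
    (u : Fin n → ℝ) : Integrable (tiltCost s ω lam u) P :=
  integrable_of_le_of_le (measurable_tiltCost hdist s ω lam u).aestronglyMeasurable
    (Eventually.of_forall (neg_norm_le_tiltCost s ω hlam u))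
    (Eventually.of_forall fun x => tiltCost_le s ω lam u x 0) (integrable_const _)
    (((hInt 0).const_mul lam).sub (integrable_const _))

/-- Weak duality for the transport problem. -/
theorem integral_tiltCost_le_of_mem_wassersteinBall
    (hdist : Measurable fun z : X × X => dist z.1 z.2) {n : ℕ} [NeZero n] {s r : ℝ} (hs : 1 ≤ s)
    (hr : 0 ≤ r) {ω : Fin n → X} {P : Measure X} (hP : P ∈ wassersteinBall s r ω) {lam : ℝ}
    (hlam : 0 ≤ lam) (u : Fin n → ℝ) :
    ∫ x, tiltCost s ω lam u x ∂P ≤ lam * r ^ s - 1 / (n : ℝ) * ∑ j, u j := by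
  have hs0 : 0 < s := by linarith
  have hn0 : (0 : ℝ) < n := by exact_mod_cast NeZero.pos n
  have := measurableSingletonClass hdist
  have hPp := hP.1
  have hCi := integrable_tiltCost hdist ω
    (fun j => integrable_dist_rpow_of_mem_wassersteinBall hdist hs0.le hP (ω j)) hlam u
  have hW := hP.2.2
  rw [wasserstein, one_div, ENNReal.rpow_inv_le_iff hs0,
    ENNReal.ofReal_rpow_of_nonneg hr hs0.le] at hW
  classical
  -- The potential `u` as a function on the space. The points `ω j` may coincide, so the largest
  -- value is taken; `-‖u‖` is a default that keeps `v` bounded.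
  set v : X → ℝ := fun y => ⨆ j, if y = ω j then u j else -‖u‖ with hv
  have hvm : Measurable v := Measurable.iSup fun j =>
    Measurable.ite (measurableSet_singleton (ω j)) measurable_const measurable_const
  have hvge : ∀ j, u j ≤ v (ω j) := fun j => by
    have := le_ciSup (f := fun i => if ω j = ω i then u i else -‖u‖)
      (Set.finite_range _).bddAbove j
    simpa using this
  have hvnorm : ∀ y, ‖v y‖ ≤ ‖u‖ := fun y => by
    obtain ⟨j, hj⟩ := exists_eq_ciSup_of_finite (f := fun j => if y = ω j then u j else -‖u‖)
    simp only [hv]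
    rw [← hj]
    split_ifs
    · exact norm_le_pi_norm u j
    · simp
  have hpt : ∀ x i, tiltCost s ω lam u x ≤ lam * dist x (ω i) ^ s - v (ω i) := by
    intro x i
    obtain ⟨j, hj⟩ := exists_eq_ciSup_of_finite (f := fun j => if ω i = ω j then u j else -‖u‖)
    have hvi : v (ω i) = if ω i = ω j then u j else -‖u‖ := hj.symm
    rw [hvi]
    split_ifs with hij
    · rw [hij]; exact tiltCost_le s ω lam u x j
    · have h1 := tiltCost_le s ω lam u x i
      have h2 := neg_le_of_abs_le (norm_le_pi_norm u i)
      linarith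
  have key : ∀ ε : ℝ, 0 < ε →
      ∫ x, tiltCost s ω lam u x ∂P ≤ lam * (r ^ s + ε) - 1 / (n : ℝ) * ∑ j, u j := by
    intro ε hε
    have hrs : 0 ≤ r ^ s := Real.rpow_nonneg hr s
    have hlt := lt_of_le_of_lt hW ((ENNReal.ofReal_lt_ofReal_iff (by linarith)).2
      (show r ^ s < r ^ s + ε by linarith))
    simp only [iInf_lt_iff] at hlt
    obtain ⟨Γ, ⟨hΓ1, hΓ2⟩, hcost⟩ := hlt
    simp_rw [edist_rpow_eq_ofReal hs0.le] at hcost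
    have hΓp : IsProbabilityMeasure Γ := by
      refine ⟨?_⟩
      rw [← Set.preimage_univ (f := Prod.fst), ← Measure.map_apply measurable_fst MeasurableSet.univ,
        hΓ1, measure_univ]
    have hdi : Integrable (fun z : X × X => dist z.1 z.2 ^ s) Γ := by
      refine ⟨(hdist.pow_const s).aestronglyMeasurable, ?_⟩
      rw [hasFiniteIntegral_iff_ofReal
        (Eventually.of_forall fun z => Real.rpow_nonneg dist_nonneg s)]
      exact hcost.trans ENNReal.ofReal_lt_top
    have hdle : ∫ z : X × X, dist z.1 z.2 ^ s ∂Γ ≤ r ^ s + ε := by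
      rw [← ofReal_integral_eq_lintegral_ofReal hdi
        (Eventually.of_forall fun z => Real.rpow_nonneg dist_nonneg s)] at hcost
      exact (ENNReal.ofReal_le_ofReal_iff (by linarith)).1 hcost.le
    have hvi : Integrable (fun z : X × X => v z.2) Γ :=
      Integrable.of_bound (C := ‖u‖) (hvm.comp measurable_snd).aestronglyMeasurable
        (Eventually.of_forall fun z => hvnorm z.2)
    have hrange : ∀ᵐ z ∂Γ, z.2 ∈ Set.range ω := by
      have h1 : ∀ᵐ y ∂(Γ.map Prod.snd), y ∈ Set.range ω := by
        rw [hΓ2, ae_iff]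
        simp [empirical]
      exact ae_of_ae_map measurable_snd.aemeasurable h1
    have hvint : 1 / (n : ℝ) * ∑ j, u j ≤ ∫ z : X × X, v z.2 ∂Γ := by
      rw [← integral_map measurable_snd.aemeasurable hvm.aestronglyMeasurable, hΓ2, empirical,
        integral_smul_measure, integral_finsetSum_measure]
      · simp only [integral_dirac, ENNReal.toReal_inv, ENNReal.toReal_natCast, smul_eq_mul, one_div]
        gcongr with j
        exact hvge j
      · intro j _
        exact integrable_dirac (by simp)
    calc ∫ x, tiltCost s ω lam u x ∂P = ∫ z, tiltCost s ω lam u z.1 ∂Γ := by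
          rw [← hΓ1, integral_map measurable_fst.aemeasurable
            (measurable_tiltCost hdist s ω lam u).aestronglyMeasurable]
      _ ≤ ∫ z, (lam * dist z.1 z.2 ^ s - v z.2) ∂Γ := by
          refine integral_mono_ae ?_ ((hdi.const_mul lam).sub hvi) ?_
          · rw [← hΓ1] at hCi
            exact hCi.comp_measurable measurable_fst
          · filter_upwards [hrange] with z hz
            obtain ⟨i, hi⟩ := hz
            rw [← hi]
            exact hpt z.1 i
      _ = lam * ∫ z, dist z.1 z.2 ^ s ∂Γ - ∫ z, v z.2 ∂Γ := by
          rw [integral_sub (hdi.const_mul lam) hvi, integral_const_mul]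
      _ ≤ _ := by gcongr
  have hlim : Tendsto (fun ε : ℝ => lam * (r ^ s + ε) - 1 / (n : ℝ) * ∑ j, u j) (𝓝[>] 0)
      (𝓝 (lam * r ^ s - 1 / (n : ℝ) * ∑ j, u j)) := by
    have : Continuous fun ε : ℝ => lam * (r ^ s + ε) - 1 / (n : ℝ) * ∑ j, u j := by fun_prop
    simpa using (this.tendsto 0).mono_left nhdsWithin_le_nhds
  exact ge_of_tendsto hlim (eventually_nhdsWithin_of_forall fun ε hε => key ε hε)

end DRCuSum

namespace DRCuSum

/-! ### Least favorable distributions -/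

/-- Integrability of the single cost with dual variables `(1, 0)` thus gives finite moments about
every point. -/
theorem dist_rpow_le {X : Type*} [MetricSpace X] {n : ℕ} [NeZero n] {s : ℝ} (hs : 1 ≤ s) (ω : Fin n → X) (x y : X) :
    dist x y ^ s ≤ 2 ^ s * (tiltCost s ω 1 0 x + (∑ j, dist (ω j) y) ^ s) := by
  obtain ⟨j, hj⟩ := exists_tiltCost_eq s ω 1 0 x
  simp only [Pi.zero_apply, sub_zero, one_mul] at hj
  rw [hj]
  set D := ∑ j, dist (ω j) y with hD
  have hD0 : 0 ≤ D := Finset.sum_nonneg fun _ _ => dist_nonneg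
  have h1 : dist x y ≤ 2 * max (dist x (ω j)) D := by
    have h2 : dist (ω j) y ≤ D := Finset.single_le_sum (f := fun j => dist (ω j) y)
      (fun _ _ => dist_nonneg) (Finset.mem_univ j)
    linarith [dist_triangle x (ω j) y, le_max_left (dist x (ω j)) D,
      le_max_right (dist x (ω j)) D]
  have hs0 : 0 ≤ s := by linarith
  have hm0 : 0 ≤ max (dist x (ω j)) D := le_max_of_le_right hD0
  refine (Real.rpow_le_rpow dist_nonneg h1 hs0).trans ?_
  rw [Real.mul_rpow two_pos.le hm0]
  gcongr
  have h3 : 0 ≤ dist x (ω j) ^ s := Real.rpow_nonneg dist_nonneg s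
  have h4 : 0 ≤ D ^ s := Real.rpow_nonneg hD0 s
  rcases max_cases (dist x (ω j)) D with ⟨h, -⟩ | ⟨h, -⟩ <;> rw [h] <;> linarith

section LeastFavorable

variable {X : Type*} [MetricSpace X] [MeasurableSpace X]

theorem integral_exp_tilted_eq (hdist : Measurable fun z : X × X => dist z.1 z.2)
    (Q : Measure X) [IsProbabilityMeasure Q] {n : ℕ} [NeZero n] (s : ℝ) (ω : Fin n → X) {lam : ℝ}
    (hlam : 0 ≤ lam) (u : Fin n → ℝ) (g : X → ℝ) :
    ∫ x, Real.exp (g x) ∂(tilted Q s ω lam u) =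
      (∫ x, Real.exp (-tiltCost s ω lam u x + g x) ∂Q) / tiltMass Q s ω lam u := by
  rw [tilted_eq_tilted hdist Q s ω hlam u, integral_exp_tilted]
  rfl

/-- Moving the dual variables in the direction `(1, v)`. -/
theorem IsDualSolution.one_sub_le_integral_exp
    (hdist : Measurable fun z : X × X => dist z.1 z.2) {Q : Measure X} [IsProbabilityMeasure Q]
    {n : ℕ} [NeZero n] {s r : ℝ} {ω : Fin n → X} {lam : ℝ} {u : Fin n → ℝ}
    (h : IsDualSolution Q s r ω lam u) (v : Fin n → ℝ) {t : ℝ} (ht : 0 < t) :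
    1 - t * (r ^ s - 1 / (n : ℝ) * ∑ j, v j) ≤
      ∫ x, Real.exp (-(t * tiltCost s ω 1 v x)) ∂(tilted Q s ω lam u) := by
  have hlam := h.1
  have hlam' : 0 ≤ lam + t * 1 := by linarith
  have hη := tiltMass_pos hdist Q s ω hlam u
  have hη' := tiltMass_pos hdist Q s ω hlam' (u + t • v)
  have hopt := h.2 (lam + t * 1) (u + t • v) hlam'
  simp only [dualObjective, Pi.add_apply, Pi.smul_apply, smul_eq_mul, Finset.sum_add_distrib,
    ← Finset.mul_sum] at hopt
  set E := ∫ x, Real.exp (-(t * tiltCost s ω 1 v x)) ∂(tilted Q s ω lam u) with hE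
  have hEeq : E * tiltMass Q s ω lam u =
      ∫ x, Real.exp (-tiltCost s ω lam u x + -(t * tiltCost s ω 1 v x)) ∂Q := by
    rw [hE, integral_exp_tilted_eq hdist Q s ω hlam u, div_mul_cancel₀ _ hη.ne']
  -- By superadditivity the moved cost is at least the sum of the old cost and `t` times the cost at
  -- `(1, v)`.
  have hle : tiltMass Q s ω (lam + t * 1) (u + t • v) ≤ E * tiltMass Q s ω lam u := by
    rw [hEeq]
    have hm1 := measurable_tiltCost hdist s ω lam u
    have hm2 := measurable_tiltCost hdist s ω 1 v
    refine integral_mono (integrable_exp_neg_tiltCost hdist Q s ω hlam' _) ?_ fun x => ?_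
    · refine Integrable.of_bound (C := Real.exp (‖u‖ + t * ‖v‖)) (by fun_prop)
        (Eventually.of_forall fun x => ?_)
      rw [Real.norm_of_nonneg (Real.exp_pos _).le]
      gcongr
      · linarith [neg_norm_le_tiltCost s ω hlam u x]
      · rw [← mul_neg]
        exact mul_le_mul_of_nonneg_left
          (by linarith [neg_norm_le_tiltCost s ω zero_le_one v x]) ht.le
    · refine Real.exp_le_exp.2 ?_
      have h1 := tiltCost_add_le s ω lam (t * 1) u (t • v) x
      rw [tiltCost_smul s ω ht.le 1 v x] at h1
      linarith
  have hE0 : 0 < E := by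
    by_contra hcon
    have := mul_nonpos_of_nonpos_of_nonneg (not_lt.1 hcon) hη.le
    linarith
  have hlog := Real.log_le_log hη' hle
  rw [Real.log_mul hE0.ne' hη.ne'] at hlog
  have hE1 := Real.log_le_sub_one_of_pos hE0
  rw [mul_add] at hopt
  have hring : 1 / (n : ℝ) * (t * ∑ j, v j) = t * (1 / (n : ℝ) * ∑ j, v j) := by ring
  rw [hring] at hopt
  nlinarith

/-- The first-order condition as `t ↓ 0`. No moments of `Q` are assumed, so integrability is itself
extracted from optimality. -/
theorem IsDualSolution.integral_tiltCost_le (hdist : Measurable fun z : X × X => dist z.1 z.2)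
    {Q : Measure X} [IsProbabilityMeasure Q] {n : ℕ} [NeZero n] {s r : ℝ} {ω : Fin n → X}
    {lam : ℝ} {u : Fin n → ℝ} (h : IsDualSolution Q s r ω lam u) (v : Fin n → ℝ) :
    Integrable (tiltCost s ω 1 v) (tilted Q s ω lam u) ∧
      ∫ x, tiltCost s ω 1 v x ∂(tilted Q s ω lam u) ≤ r ^ s - 1 / (n : ℝ) * ∑ j, v j := by
  have := isProbabilityMeasure_tilted_tiltCost hdist Q s ω h.1 u
  exact integrable_and_integral_le_of_forall_exp _ (measurable_tiltCost hdist s ω 1 v)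
    (norm_nonneg v) (neg_norm_le_tiltCost s ω zero_le_one v)
    fun t ht _ => h.one_sub_le_integral_exp hdist v ht

theorem IsDualSolution.tilted_mem_wassersteinBall
    (hdist : Measurable fun z : X × X => dist z.1 z.2) {Q : Measure X} [IsProbabilityMeasure Q]
    {n : ℕ} [NeZero n] {s r : ℝ} (hs : 1 ≤ s) (hr : 0 ≤ r) {ω : Fin n → X} {lam : ℝ}
    {u : Fin n → ℝ} (h : IsDualSolution Q s r ω lam u) :
    tilted Q s ω lam u ∈ wassersteinBall s r ω := by
  have hprob := isProbabilityMeasure_tilted_tiltCost hdist Q s ω h.1 u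
  have hInt : ∀ y, Integrable (fun x => dist x y ^ s) (tilted Q s ω lam u) := fun y =>
    Integrable.mono' (((h.integral_tiltCost_le hdist 0).1.add (integrable_const _)).const_mul _)
      ((measurable_dist_left hdist y).pow_const s).aestronglyMeasurable
      (Eventually.of_forall fun x => by
        rw [Real.norm_of_nonneg (Real.rpow_nonneg dist_nonneg s)]
        exact dist_rpow_le hs ω x y)
  refine ⟨hprob, fun y => ?_, ?_⟩
  · simp_rw [edist_rpow_eq_ofReal (by linarith : 0 ≤ s)]
    exact (hasFiniteIntegral_iff_ofReal
      (Eventually.of_forall fun x => Real.rpow_nonneg dist_nonneg s)).1 (hInt y).2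
  · refine wasserstein_le_of_forall_dual hdist (NeZero.pos n) hs hr ω _ (fun j => hInt _) fun v => ?_
    linarith [(h.integral_tiltCost_le hdist v).2]

/-- Complementary slackness: scaling the dual variables towards `0`. -/
theorem IsDualSolution.le_integral_tiltCost (hdist : Measurable fun z : X × X => dist z.1 z.2)
    {Q : Measure X} [IsProbabilityMeasure Q] {n : ℕ} [NeZero n] {s r : ℝ} {ω : Fin n → X}
    {lam : ℝ} {u : Fin n → ℝ} (h : IsDualSolution Q s r ω lam u) :
    lam * r ^ s - 1 / (n : ℝ) * ∑ j, u j ≤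
      ∫ x, tiltCost s ω lam u x ∂(tilted Q s ω lam u) := by
  have hlam := h.1
  have hη := tiltMass_pos hdist Q s ω hlam u
  have hprob := isProbabilityMeasure_tilted_tiltCost hdist Q s ω hlam u
  have hprob' : IsProbabilityMeasure
      (Q.withDensity fun y => ENNReal.ofReal (Real.exp (logLR Q s ω lam u y))) := hprob
  have h0 := zero_mem_interior_integrableExpSet Q (measurable_logLR hdist Q s ω lam u)
    (logLR_le Q s ω hlam u) (-Real.log (tiltMass Q s ω lam u))
  have hfun : (fun y => logLR Q s ω lam u y - -Real.log (tiltMass Q s ω lam u)) =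
      fun y => -tiltCost s ω lam u y := by
    ext y; rw [logLR]; ring
  rw [hfun] at h0
  -- The cost is homogeneous, so scaling `(lam, u)` by `1 + t` turns the normalizer into a moment
  -- generating function of the negative cost. Its left slopes give the lower bound on the mean
  -- cost.
  have hder := (hasDerivAt_mgf h0).tendsto_slope_zero_left
  simp only [zero_mul, Real.exp_zero, mul_one, integral_neg, zero_add, mgf_zero,
    smul_eq_mul] at hder
  set R := lam * r ^ s - 1 / (n : ℝ) * ∑ j, u j with hR
  have hev : ∀ᶠ t : ℝ in 𝓝[<] 0, t⁻¹ * (mgf (fun y => -tiltCost s ω lam u y)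
      (Q.withDensity fun y => ENNReal.ofReal (Real.exp (logLR Q s ω lam u y))) t - 1) ≤ -R := by
    filter_upwards [Ioo_mem_nhdsLT (show (-1 : ℝ) < 0 by norm_num)] with t ht
    have ht1 : 0 ≤ 1 + t := by linarith [ht.1]
    have hlam' : 0 ≤ (1 + t) * lam := mul_nonneg ht1 hlam
    have hη' := tiltMass_pos hdist Q s ω hlam' ((1 + t) • u)
    have hopt := h.2 ((1 + t) * lam) ((1 + t) • u) hlam'
    simp only [dualObjective, Pi.smul_apply, smul_eq_mul, ← Finset.mul_sum] at hopt
    have hmgf : mgf (fun y => -tiltCost s ω lam u y)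
        (Q.withDensity fun y => ENNReal.ofReal (Real.exp (logLR Q s ω lam u y))) t =
        tiltMass Q s ω ((1 + t) * lam) ((1 + t) • u) / tiltMass Q s ω lam u := by
      have h1 := integral_exp_tilted_eq hdist Q s ω hlam u
        (fun y => t * -tiltCost s ω lam u y)
      rw [mgf]
      refine h1.trans ?_
      congr 1
      rw [tiltMass]
      refine integral_congr_ae (Eventually.of_forall fun y => ?_)
      simp only [tiltCost_smul s ω ht1]
      congr 1; ring
    rw [hmgf]
    have hlog := Real.log_le_sub_one_of_pos (div_pos hη' hη)
    rw [Real.log_div hη'.ne' hη.ne'] at hlog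
    have hge : -t * R ≤ tiltMass Q s ω ((1 + t) * lam) ((1 + t) • u) / tiltMass Q s ω lam u - 1 := by
      refine le_trans ?_ hlog
      rw [hR]
      linarith
    have h2 := mul_le_mul_of_nonpos_left hge (inv_lt_zero.2 ht.2).le
    have h3 : t⁻¹ * (-t * R) = -R := by
      have := ht.2.ne
      field_simp
    linarith
  have := le_of_tendsto hder hev
  change -∫ x, tiltCost s ω lam u x ∂(tilted Q s ω lam u) ≤ -R at this
  linarith

theorem integrable_logLR_of_mem_wassersteinBall
    (hdist : Measurable fun z : X × X => dist z.1 z.2) (Q : Measure X) {n : ℕ} [NeZero n]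
    {s r : ℝ} (hs : 1 ≤ s) {ω : Fin n → X} {lam : ℝ} (hlam : 0 ≤ lam) (u : Fin n → ℝ)
    {P : Measure X} (hP : P ∈ wassersteinBall s r ω) : Integrable (logLR Q s ω lam u) P := by
  have := hP.1
  exact (integrable_tiltCost hdist ω (fun j => integrable_dist_rpow_of_mem_wassersteinBall hdist
    (by linarith) hP (ω j)) hlam u).neg.sub (integrable_const _)

theorem integral_logLR (hdist : Measurable fun z : X × X => dist z.1 z.2) (Q : Measure X)
    {n : ℕ} [NeZero n] {s r : ℝ} (hs : 1 ≤ s) {ω : Fin n → X} {lam : ℝ} (hlam : 0 ≤ lam)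
    (u : Fin n → ℝ) {P : Measure X} (hP : P ∈ wassersteinBall s r ω) :
    ∫ x, logLR Q s ω lam u x ∂P =
      -∫ x, tiltCost s ω lam u x ∂P - Real.log (tiltMass Q s ω lam u) := by
  have := hP.1
  have hCi := integrable_tiltCost hdist ω (fun j => integrable_dist_rpow_of_mem_wassersteinBall
    hdist (by linarith) hP (ω j)) hlam u
  simp only [logLR]
  rw [integral_sub (by exact hCi.neg) (integrable_const _), integral_neg]
  simp

/-- The mean of the log-likelihood ratio is smallest at the tilted measure. -/
theorem IsDualSolution.integral_logLR_le (hdist : Measurable fun z : X × X => dist z.1 z.2)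
    {Q : Measure X} [IsProbabilityMeasure Q] {n : ℕ} [NeZero n] {s r : ℝ} (hs : 1 ≤ s)
    (hr : 0 ≤ r) {ω : Fin n → X} {lam : ℝ} {u : Fin n → ℝ} (h : IsDualSolution Q s r ω lam u)
    {P : Measure X} (hP : P ∈ wassersteinBall s r ω) :
    ∫ x, logLR Q s ω lam u x ∂(tilted Q s ω lam u) ≤ ∫ x, logLR Q s ω lam u x ∂P := by
  rw [integral_logLR hdist Q hs h.1 u hP,
    integral_logLR hdist Q hs h.1 u (h.tilted_mem_wassersteinBall hdist hs hr)]
  linarith [integral_tiltCost_le_of_mem_wassersteinBall hdist hs hr hP h.1 u,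
    h.le_integral_tiltCost hdist]

theorem IsDualSolution.klDiv_tilted (hdist : Measurable fun z : X × X => dist z.1 z.2)
    {Q : Measure X} [IsProbabilityMeasure Q] {n : ℕ} [NeZero n] {s r : ℝ} (hs : 1 ≤ s)
    (hr : 0 ≤ r) {ω : Fin n → X} {lam : ℝ} {u : Fin n → ℝ} (h : IsDualSolution Q s r ω lam u) :
    klDiv (tilted Q s ω lam u) Q =
      ENNReal.ofReal (∫ x, logLR Q s ω lam u x ∂(tilted Q s ω lam u)) := by
  have hprob := isProbabilityMeasure_tilted_tiltCost hdist Q s ω h.1 u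
  have hInt := integrable_logLR_of_mem_wassersteinBall hdist Q hs h.1 u
    (h.tilted_mem_wassersteinBall hdist hs hr)
  have hac : tilted Q s ω lam u ≪ Q := withDensity_absolutelyContinuous _ _
  have hllr : llr (tilted Q s ω lam u) Q =ᵐ[tilted Q s ω lam u] logLR Q s ω lam u := by
    refine hac.ae_le ?_
    rw [tilted_eq_tilted hdist Q s ω h.1 u]
    exact log_rnDeriv_tilted_left_self (integrable_exp_neg_tiltCost hdist Q s ω h.1 u)
  rw [klDiv_of_ac_of_integrable hac ((integrable_congr hllr).2 hInt), integral_congr_ae hllr]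
  simp

/-- The Donsker–Varadhan lower bound for a log-likelihood ratio. -/
theorem integral_logLR_le_klDiv (hdist : Measurable fun z : X × X => dist z.1 z.2)
    (Q : Measure X) [IsProbabilityMeasure Q] {n : ℕ} [NeZero n] {s r : ℝ} (hs : 1 ≤ s)
    {ω : Fin n → X} {lam : ℝ} (hlam : 0 ≤ lam) (u : Fin n → ℝ) {P : Measure X}
    (hP : P ∈ wassersteinBall s r ω) :
    ENNReal.ofReal (∫ x, logLR Q s ω lam u x ∂P) ≤ klDiv P Q := by
  have := hP.1
  by_cases hkl : klDiv P Q = ∞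
  · rw [hkl]; exact le_top
  obtain ⟨hac, hllr⟩ := klDiv_ne_top_iff.1 hkl
  have hCi := integrable_tiltCost hdist ω (fun j => integrable_dist_rpow_of_mem_wassersteinBall
    hdist (by linarith) hP (ω j)) hlam u
  have hexp := integrable_exp_neg_tiltCost hdist Q s ω hlam u
  have hQp := isProbabilityMeasure_tilted hexp
  -- Nonnegativity of the divergence of `P` from the tilted measure, expanded through the tilting.
  have hnn := integral_llr_add_sub_measure_univ_nonneg
    (hac.trans (absolutelyContinuous_tilted hexp))
    (integrable_llr_tilted_right hac hCi.neg hllr hexp)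
  rw [integral_llr_tilted_right (f := fun x => -tiltCost s ω lam u x) hac hCi.neg hexp hllr] at hnn
  rw [klDiv_of_ac_of_integrable hac hllr, integral_logLR hdist Q hs hlam u hP]
  simp only [integral_neg, probReal_univ] at hnn ⊢
  refine ENNReal.ofReal_le_ofReal ?_
  change 0 ≤ ∫ x, llr P Q x ∂P - -∫ x, tiltCost s ω lam u x ∂P +
    Real.log (tiltMass Q s ω lam u) + 1 - 1 at hnn
  linarith

/-- $\mathsf{KL}(P^*\|Q)=\int Z\,dP^*\le\int Z\,dP\le\mathsf{KL}(P\|Q)$. -/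
theorem IsDualSolution.isLFD (hdist : Measurable fun z : X × X => dist z.1 z.2)
    {Q : Measure X} [IsProbabilityMeasure Q] {n : ℕ} [NeZero n] {s r : ℝ} (hs : 1 ≤ s)
    (hr : 0 ≤ r) {ω : Fin n → X} {lam : ℝ} {u : Fin n → ℝ} (h : IsDualSolution Q s r ω lam u) :
    IsLFD Q (wassersteinBall s r ω) (tilted Q s ω lam u) := by
  refine ⟨h.tilted_mem_wassersteinBall hdist hs hr, fun P hP => ?_⟩
  rw [h.klDiv_tilted hdist hs hr]
  exact (ENNReal.ofReal_le_ofReal (h.integral_logLR_le hdist hs hr hP)).trans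
    (integral_logLR_le_klDiv hdist Q hs h.1 u hP)

end LeastFavorable

/-! ### First-order asymptotics -/

/-- Both `f` and `g` are squeezed against `log γ / I`; the additive `K` disappears in the limit. -/
theorem firstOrderEq_of_bounds {f g : ℝ → ℝ≥0∞} {I K : ℝ} (hI : 0 < I)
    (hlow : ∀ c : ℝ, 0 < c → c * I < 1 →
      ∀ᶠ γ : ℝ in atTop, ENNReal.ofReal (c * Real.log γ) ≤ g γ)
    (hgf : ∀ᶠ γ in atTop, g γ ≤ f γ)
    (hup : ∀ᶠ γ : ℝ in atTop, f γ ≤ ENNReal.ofReal ((Real.log γ + K) / I)) :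
    FirstOrderEq f g ∧
      FirstOrderEq f fun γ => ENNReal.ofReal (Real.log γ) / ENNReal.ofReal I := by
  set h : ℝ → ℝ≥0∞ := fun γ => ENNReal.ofReal (Real.log γ) / ENNReal.ofReal I with hh
  have hlogpos : ∀ᶠ γ : ℝ in atTop, 0 < Real.log γ :=
    Real.tendsto_log_atTop.eventually (eventually_gt_atTop 0)
  have hheq : ∀ γ, h γ = ENNReal.ofReal (Real.log γ / I) := fun γ =>
    (ENNReal.ofReal_div_of_pos hI).symm
  have hlim : Tendsto (fun γ : ℝ => ENNReal.ofReal (1 + K / Real.log γ)) atTop (𝓝 1) := by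
    have h1 : Tendsto (fun γ : ℝ => 1 + K / Real.log γ) atTop (𝓝 (1 + 0)) :=
      (tendsto_const_nhds.div_atTop Real.tendsto_log_atTop).const_add 1
    have h2 := (ENNReal.continuous_ofReal.tendsto _).comp h1
    simpa [Function.comp_def] using h2
  have hupper : ∀ᶠ γ in atTop, f γ / h γ ≤ ENNReal.ofReal (1 + K / Real.log γ) := by
    filter_upwards [hup, hlogpos] with γ h1 h2
    refine ENNReal.div_le_of_le_mul (h1.trans ?_)
    rw [hheq, ← ENNReal.ofReal_mul' (by positivity)]
    refine ENNReal.ofReal_le_ofReal (le_of_eq ?_)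
    field_simp
  have hlower : ∀ a < (1 : ℝ≥0∞), ∀ᶠ γ in atTop, a < g γ / h γ := by
    intro a ha
    lift a to NNReal using (ha.trans ENNReal.one_lt_top).ne
    have ha1 : (a : ℝ) < 1 := by exact_mod_cast ha
    -- Makes `c * I` the midpoint of `a` and `1`, hence admissible and still above `a`.
    set c := ((a : ℝ) + 1) / 2 / I with hc
    have hcI : c * I = ((a : ℝ) + 1) / 2 := by rw [hc]; field_simp
    filter_upwards [hlow c (by positivity) (by rw [hcI]; linarith), hlogpos] with γ h1 h2
    have h3 : (a : ℝ≥0∞) < ENNReal.ofReal (c * I) := by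
      rw [← ENNReal.ofReal_coe_nnreal, ENNReal.ofReal_lt_ofReal_iff (by rw [hcI]; positivity), hcI]
      linarith
    refine h3.trans_le ?_
    have hpos : 0 < Real.log γ / I := by positivity
    rw [hheq, ENNReal.le_div_iff_mul_le (by simp [hpos]) (by simp),
      ← ENNReal.ofReal_mul (by rw [hcI]; positivity)]
    refine le_trans (ENNReal.ofReal_le_ofReal (le_of_eq ?_)) h1
    field_simp
  have hf : Tendsto (fun γ => f γ / h γ) atTop (𝓝 1) := by
    refine tendsto_order.2 ⟨fun a ha => ?_, fun a ha => ?_⟩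
    · filter_upwards [hlower a ha, hgf] with γ h1 h2
      exact h1.trans_le (ENNReal.div_le_div_right h2 _)
    · filter_upwards [hlim.eventually (gt_mem_nhds ha), hupper] with γ h1 h2
      exact h2.trans_lt h1
  have hg : Tendsto (fun γ => g γ / h γ) atTop (𝓝 1) := by
    refine tendsto_order.2 ⟨hlower, fun a ha => ?_⟩
    filter_upwards [hlim.eventually (gt_mem_nhds ha), hupper, hgf] with γ h1 h2 h3
    exact ((ENNReal.div_le_div_right h3 _).trans h2).trans_lt h1
  refine ⟨?_, hf⟩
  have hdiv := ENNReal.Tendsto.div hf (Or.inl one_ne_zero) hg (Or.inl ENNReal.one_ne_top)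
  rw [div_one] at hdiv
  refine hdiv.congr' ?_
  filter_upwards [hlogpos] with γ h1
  have hpos : 0 < Real.log γ / I := by positivity
  rw [div_eq_mul_inv (f γ) (h γ), div_eq_mul_inv (g γ) (h γ), ENNReal.mul_div_mul_right]
  · rw [hheq]; simp
  · rw [hheq]; simp [hpos]

end DRCuSum

theorem theorem3 {X : Type*} [MetricSpace X] [MeasurableSpace X]
    (hdist : Measurable fun z : X × X => dist z.1 z.2)
    (Q : Measure X) [IsProbabilityMeasure Q] (s : ℝ) (hs : 1 ≤ s)
    (M : ℕ) (hM : 1 ≤ M) (n : Fin M → ℕ) (hn : ∀ m, 1 ≤ n m)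
    (ω : (m : Fin M) → Fin (n m) → X) (r : Fin M → ℝ) (hr : ∀ m, 0 ≤ r m)
    (𝒰 : Set (Measure X)) (hU : 𝒰 = ⋃ m, DRCuSum.wassersteinBall s (r m) (ω m))
    (hQ : Q ∉ 𝒰)
    (lam : Fin M → ℝ) (u : (m : Fin M) → Fin (n m) → ℝ)
    (hdual : ∀ m, DRCuSum.IsDualSolution Q s (r m) (ω m) (lam m) (u m))
    (Pstar : Fin M → Measure X)
    (hPstar : ∀ m, Pstar m = DRCuSum.tilted Q s (ω m) (lam m) (u m))
    (Istar : ℝ≥0∞) (hIstar : Istar = ⨅ m, klDiv (Pstar m) Q)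
    (τDR : ℝ → (ℕ → X) → ℕ∞)
    (hτDR : ∀ b, τDR b =
      DRCuSum.cusumTest (fun m => DRCuSum.logLR Q s (ω m) (lam m) (u m)) b) :
    (∀ m, DRCuSum.IsLFD Q (DRCuSum.wassersteinBall s (r m) (ω m)) (Pstar m)) ∧
    (∀ γ : ℝ, 0 < γ → τDR (Real.log (M * γ)) ∈ DRCuSum.tests Q γ) ∧
    DRCuSum.FirstOrderEq
      (fun γ => DRCuSum.worstDelay Q 𝒰 (τDR (Real.log (M * γ))))
      (fun γ => DRCuSum.minimaxDelay Q 𝒰 γ) ∧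
    DRCuSum.FirstOrderEq
      (fun γ => DRCuSum.worstDelay Q 𝒰 (τDR (Real.log (M * γ))))
      (fun γ => ENNReal.ofReal (Real.log γ) / Istar) := by
  have hne : ∀ m, NeZero (n m) := fun m => ⟨by have := hn m; omega⟩
  have hMne : Nonempty (Fin M) := ⟨⟨0, hM⟩⟩
  have hM0 : (0 : ℝ) < M := by exact_mod_cast hM
  obtain rfl : τDR = _ := funext hτDR
  obtain rfl : Pstar = _ := funext hPstar
  set Z : (m : Fin M) → X → ℝ := fun m => DRCuSum.logLR Q s (ω m) (lam m) (u m) with hZdef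
  set P : Fin M → Measure X := fun m => DRCuSum.tilted Q s (ω m) (lam m) (u m) with hPdef
  have hprob : ∀ m, IsProbabilityMeasure (P m) := fun m =>
    DRCuSum.isProbabilityMeasure_tilted_tiltCost hdist Q s (ω m) (hdual m).1 (u m)
  have hZm : ∀ m, Measurable (Z m) := fun m =>
    DRCuSum.measurable_logLR hdist Q s (ω m) (lam m) (u m)
  have hZ1 : ∀ m, ∫⁻ y, ENNReal.ofReal (Real.exp (Z m y)) ∂Q = 1 := fun m => by
    have h1 : Q.withDensity (fun y => ENNReal.ofReal (Real.exp (Z m y))) Set.univ = 1 :=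
      (hprob m).measure_univ
    rwa [withDensity_apply _ MeasurableSet.univ, Measure.restrict_univ] at h1
  have hball : ∀ m, P m ∈ DRCuSum.wassersteinBall s (r m) (ω m) := fun m =>
    (hdual m).tilted_mem_wassersteinBall hdist hs (hr m)
  have hPU : ∀ m, P m ∈ 𝒰 := fun m => by
    rw [hU]; exact Set.mem_iUnion.2 ⟨m, hball m⟩
  have hkl : ∀ m, klDiv (P m) Q = ENNReal.ofReal (∫ x, Z m x ∂(P m)) := fun m =>
    (hdual m).klDiv_tilted hdist hs (hr m)
  -- Zero divergence would make `P m` equal to `Q`, which lies outside the uncertainty class.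
  have hI : ∀ m, 0 < ∫ x, Z m x ∂(P m) := fun m => by
    by_contra hcon
    have h1 := hkl m
    rw [ENNReal.ofReal_eq_zero.2 (not_lt.1 hcon), klDiv_eq_zero_iff] at h1
    exact hQ (h1 ▸ hPU m)
  obtain ⟨m₀, hm₀⟩ := Finite.exists_min fun m => ∫ x, Z m x ∂(P m)
  set I := ∫ x, Z m₀ x ∂(P m₀) with hIdef
  have hIeq : Istar = ENNReal.ofReal I := by
    rw [hIstar]
    refine le_antisymm ((iInf_le _ m₀).trans (hkl m₀).le) (le_iInf fun m => ?_)
    rw [hkl m]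
    exact ENNReal.ofReal_le_ofReal (hm₀ m)
  choose k hk using fun m => (⟨_, DRCuSum.logLR_le Q s (ω m) (hdual m).1 (u m)⟩ :
    ∃ k, ∀ x, Z m x ≤ k)
  obtain ⟨m₁, hm₁⟩ := Finite.exists_max k
  have htests : ∀ γ : ℝ, 0 < γ → DRCuSum.cusumTest Z (Real.log (M * γ)) ∈ DRCuSum.tests Q γ :=
    fun γ hγ => DRCuSum.cusumTest_mem_tests Q hM hZm hZ1 hγ
  refine ⟨fun m => (hdual m).isLFD hdist hs (hr m), htests, ?_⟩
  rw [hIeq]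
  -- The additive constant collects `log M` from the threshold and the largest overshoot bound over
  -- `m`.
  refine DRCuSum.firstOrderEq_of_bounds (K := Real.log M + k m₁) (hI m₀) ?_ ?_ ?_
  · intro c hc hcI
    filter_upwards [DRCuSum.eventually_le_WADD Q (hZm m₀) (P := P m₀) rfl (hk m₀)
      (DRCuSum.integrable_logLR_of_mem_wassersteinBall hdist Q hs (hdual m₀).1 (u m₀) (hball m₀))
      (hI m₀) hc hcI] with γ hγ
    refine le_iInf₂ fun τ hτ => (hγ τ hτ).trans ?_
    exact le_iSup₂ (f := fun P (_ : P ∈ 𝒰) => DRCuSum.WADD Q P τ) (P m₀) (hPU m₀)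
  · filter_upwards [eventually_gt_atTop 0] with γ hγ
    exact iInf₂_le _ (htests γ hγ)
  · filter_upwards [eventually_ge_atTop 1] with γ hγ
    have hb : 0 ≤ Real.log (M * γ) :=
      Real.log_nonneg (by nlinarith [(show (1 : ℝ) ≤ M by exact_mod_cast hM)])
    refine iSup₂_le fun P' hP' => ?_
    rw [hU] at hP'
    obtain ⟨m, hm⟩ := Set.mem_iUnion.1 hP'
    have := hm.1
    -- Only the statistic of a ball containing `P'` is used; its drift is at least that ball's
    -- divergence, hence at least `I`.
    have h1 := DRCuSum.WADD_cusumTest_le Q P' m (hZm m) hb (hI m₀)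
      (fun y => (hk m y).trans (hm₁ m))
      (DRCuSum.integrable_logLR_of_mem_wassersteinBall hdist Q hs (hdual m).1 (u m) hm)
      ((hm₀ m).trans ((hdual m).integral_logLR_le hdist hs (hr m) hm))
    refine h1.trans (le_of_eq ?_)
    rw [Real.log_mul hM0.ne' (by linarith : γ ≠ 0)]
    congr 1; ring
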